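/- Let $X$ be a paracompact topological space, $H$ a complex Hilbert space, and let $\mathcal{CF}^{\rm sa}$ be the set of (possibly unbounded) self-adjoint Fredholm operators on $H$ with the gap topology, i.e. the topology of norm convergence of the resolvents $(A+i)^{-1}$. Let $F:X\to\mathcal{CF}^{\rm sa}$ be continuous with common essential spectral gap $(-1,1)$, i.e. $\sigma_{\rm ess}(F(x))\cap(-1,1)=\emptyset$ for all $x\in X$. The Fermi gerbe $\mathcal G_F$ is the following gerbe. For $\lambda\in(-1,1)$ let $U_\lambda=\{x\in X:\lambda\notin\sigma(F(x))\}$; these open sets cover $X$. Over $U_\lambda\cap U_\mu$ it has the Hermitian line bundle $\mathcal L_{\lambda\mu}$ whose fibre at $x$ is the top exterior power of the sum of the eigenspaces of $F(x)$ with eigenvalues in $(\lambda,\mu)$ if $\lambda<\mu$, the dual of $\mathcal L_{\mu\lambda}$ if $\lambda>\mu$, and $\mathbb C$ if $\lambda=\mu$. Over $U_\lambda\cap U_\mu\cap U_\nu$ it has the canonical isomorphism $\phi:\mathcal L_{\lambda\mu}\otimes\mathcal L_{\mu\nu}\to\mathcal L_{\lambda\nu}$ given by the exterior product if $\lambda<\mu<\nu$,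 and by the exterior product and duality in general. The class of $\mathcal G_F$ in the Čech cohomology group $\check H^2(X,\underline{\mathrm U(1)})$ (the direct limit over open covers; coefficients in the sheaf of continuous $\mathrm U(1)$-valued functions) is defined as follows: choose an open cover $\{V_i\}$ with $V_i\subseteq U_{\lambda_i}$ and continuous unit sections $s_{ij}$ of $\mathcal L_{\lambda_i\lambda_j}$ over $V_i\cap V_j$, and take the class of the $2$-cocycle $g$ with $\phi(s_{ij}\otimes s_{jk})=g_{ijk}\,s_{ik}$. The Dixmier–Douady invariant of $\mathcal G_F$ is this class or, equivalently when $X$ is paracompact Hausdorff, its image in $\check H^3(X,\mathbb Z)\cong\check H^2(X,\underline{\mathrm U(1)})$ under the connecting homomorphism of $0\to\mathbb Z\to\mathbb R\to\mathrm U(1)\to0$. Suppose that some $\lambda_0\in(-1,1)$ satisfies $\lambda_0\notin\sigma(F(x))$ for all $x\in X$. Then the Dixmier–Douady invariant of $\mathcal G_F$ vanishes: choices of $\{V_i\}$, $\lambda_i$, $s_{ij}$ as above exist, and every such choice has class $0$ in $\check H^2(X,\underline{\mathrm U(1)})$; and if $X$ is Hausdorff, the invariant in $\check H^3(X,\mathbb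 Z)$ is well defined and equal to $0$. -/

import Mathlib

/-! # Unbounded self-adjoint Fredholm operators and the gap topology -/

namespace FermiGerbe

open Set TopologicalSpace Topology

noncomputable section

section Operators

variable {H : Type*} [NormedAddCommGroup H] [InnerProductSpace ℂ H]

/-- `R` is a bounded two-sided inverse of `A - z : dom A → H`. -/
def IsResolventAt (A : H →ₗ.[ℂ] H) (z : ℂ) (R : H →L[ℂ] H) : Prop :=
  (∀ v : H, ∃ h : R v ∈ A.domain, A ⟨R v, h⟩ - z • R v = v) ∧
    ∀ u : A.domain, R (A u - z • (u : H)) = u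

open Classical in
/-- The resolvent `(A - z)⁻¹`, with junk value `0` when `z` is in the spectrum of `A`. -/
def resolvent (A : H →ₗ.[ℂ] H) (z : ℂ) : H →L[ℂ] H :=
  if h : ∃ R, IsResolventAt A z R then h.choose else 0

/-- The spectrum `σ(A)`; only real points are recorded, since the spectrum of a self-adjoint
operator is real. -/
def spectrum (A : H →ₗ.[ℂ] H) : Set ℝ :=
  {t | ¬ ∃ R, IsResolventAt A (t : ℂ) R}

/-- The kernel of `A - t`, as a subspace of `H`. -/
def eigenspace (A : H →ₗ.[ℂ] H) (t : ℝ) : Submodule ℂ H :=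
  (LinearMap.ker (A.toFun - (t : ℂ) • A.domain.subtype)).map A.domain.subtype

/-- The discrete spectrum `σ_d(A)`: points of the spectrum that are isolated in it and are
eigenvalues of finite multiplicity. -/
def discreteSpectrum (A : H →ₗ.[ℂ] H) : Set ℝ :=
  {t | t ∈ spectrum A ∧ (∃ ε > 0, ∀ r ∈ spectrum A, |r - t| < ε → r = t) ∧
    eigenspace A t ≠ ⊥ ∧ FiniteDimensional ℂ (eigenspace A t)}

/-- The essential spectrum `σ_ess(A)` of a self-adjoint operator. -/
def essentialSpectrum (A : H →ₗ.[ℂ] H) : Set ℝ :=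
  spectrum A \ discreteSpectrum A

/-- Finite-dimensional kernel, closed range, finite-dimensional cokernel. -/
def IsFredholm (A : H →ₗ.[ℂ] H) : Prop :=
  FiniteDimensional ℂ (LinearMap.ker A.toFun) ∧
    IsClosed (LinearMap.range A.toFun : Set H) ∧
    FiniteDimensional ℂ (H ⧸ LinearMap.range A.toFun)

variable (H) in
/-- The set of (possibly unbounded) self-adjoint Fredholm operators on `H`. -/
def CFsa [CompleteSpace H] : Type _ :=
  {A : H →ₗ.[ℂ] H // IsSelfAdjoint A ∧ IsFredholm A}

/-- The gap topology: norm convergence of the resolvents `(A + i)⁻¹`. -/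
instance [CompleteSpace H] : TopologicalSpace (CFsa H) :=
  TopologicalSpace.induced (fun A => resolvent A.1 (-Complex.I)) inferInstance

end Operators

/-! # Čech cohomology of a space with coefficients in a sheaf of continuous functions

The direct limit over open covers is taken over the covers `(V x)_{x ∈ X}` indexed by the points
of `X` with `x ∈ V x`, ordered by `V x ⊇ W x` for all `x`. Every open cover is refined by such a
cover (and each of these is an open cover), and on the level of cohomology the refinement maps do
not depend on the choice of a map of index sets, so this is the usual direct limit. -/

section Cech

variable (X : Type*) [TopologicalSpace X]

/-- An open cover of `X` indexed by the points of `X`, the set with index `x` containing `x`. -/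
structure PointedCover where
  nhd : X → Opens X
  mem : ∀ x, x ∈ nhd x

variable {X}

/-- `V ≤ W` means that `W` is finer than `V`. -/
instance : Preorder (PointedCover X) where
  le V W := ∀ x, W.nhd x ≤ V.nhd x
  le_refl _ _ := le_rfl
  le_trans _ _ _ h₁ h₂ x := (h₂ x).trans (h₁ x)

/-- The intersection `V_{i₀} ∩ ⋯ ∩ V_{iₙ}`. -/
def PointedCover.inter (V : PointedCover X) {n : ℕ} (i : Fin (n + 1) → X) : Set X :=
  {x | ∀ k, x ∈ V.nhd (i k)}

variable (A : Type*) [AddCommGroup A] [TopologicalSpace A] [IsTopologicalAddGroup A]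

/-- Čech `n`-cochains of the cover `V` with values in the sheaf of continuous `A`-valued
functions. -/
abbrev Cochain (V : PointedCover X) (n : ℕ) : Type _ :=
  ∀ i : Fin (n + 1) → X, C(V.inter i, A)

/-- The Čech differential `(δc)_{i₀…iₙ₊₁} = ∑ₖ (-1)ᵏ c_{i₀…îₖ…iₙ₊₁}`. -/
def cechD (V : PointedCover X) (n : ℕ) : Cochain A V n →+ Cochain A V (n + 1) where
  toFun c i := ∑ k : Fin (n + 2), (-1 : ℤ) ^ (k : ℕ) •
    (c (i ∘ k.succAbove)).comp
      ⟨fun x => ⟨x.1, fun l => x.2 (k.succAbove l)⟩, by fun_prop⟩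
  map_zero' := by
    funext i
    ext x
    simp
  map_add' c c' := by
    funext i
    ext x
    simp [Finset.sum_add_distrib]

/-- Čech cocycles. -/
abbrev cocycles (V : PointedCover X) (n : ℕ) : AddSubgroup (Cochain A V n) :=
  (cechD A V n).ker

/-- Čech coboundaries. -/
def coboundaries (V : PointedCover X) : (n : ℕ) → AddSubgroup (Cochain A V n)
  | 0 => ⊥
  | n + 1 => (cechD A V n).range

/-- The Čech cohomology of one cover: cocycles modulo coboundaries. -/
abbrev CoverCohomology (V : PointedCover X) (n : ℕ) : Type _ :=
  cocycles A V n ⧸ (coboundaries A V n).addSubgroupOf (cocycles A V n)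

variable {A}

/-- Restriction of cochains to a finer cover. -/
def res {V W : PointedCover X} (h : V ≤ W) (n : ℕ) : Cochain A V n →+ Cochain A W n where
  toFun c i := (c i).comp ⟨fun x => ⟨x.1, fun k => h (i k) (x.2 k)⟩, by fun_prop⟩
  map_zero' := rfl
  map_add' _ _ := rfl

theorem cechD_apply {V : PointedCover X} (n : ℕ) (c : Cochain A V n) (i : Fin (n + 2) → X)
    (x : V.inter i) : cechD A V n c i x = ∑ k : Fin (n + 2), (-1 : ℤ) ^ (k : ℕ) •
      c (i ∘ k.succAbove) ⟨x.1, fun l => x.2 (k.succAbove l)⟩ := by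
  simp [cechD]

theorem res_apply {V W : PointedCover X} (h : V ≤ W) (n : ℕ) (c : Cochain A V n)
    (i : Fin (n + 1) → X) (x : W.inter i) :
    res h n c i x = c i ⟨x.1, fun k => h (i k) (x.2 k)⟩ := rfl

theorem cechD_res {V W : PointedCover X} (h : V ≤ W) (n : ℕ) (c : Cochain A V n) :
    cechD A W n (res h n c) = res h (n + 1) (cechD A V n c) := by
  funext i
  ext x
  rw [cechD_apply, res_apply, cechD_apply]
  simp only [res_apply]

theorem res_mem_cocycles {V W : PointedCover X} (h : V ≤ W) (n : ℕ) {c : Cochain A V n}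
    (hc : c ∈ cocycles A V n) : res h n c ∈ cocycles A W n := by
  rw [AddMonoidHom.mem_ker] at hc ⊢
  rw [cechD_res, hc, map_zero]

theorem res_mem_coboundaries {V W : PointedCover X} (h : V ≤ W) (n : ℕ) {c : Cochain A V n}
    (hc : c ∈ coboundaries A V n) : res h n c ∈ coboundaries A W n := by
  cases n with
  | zero =>
    have h0 : c = 0 := hc
    subst h0
    rw [map_zero]
    exact zero_mem _
  | succ n =>
    obtain ⟨b, rfl⟩ := hc
    exact ⟨res h n b, cechD_res h n b⟩

/-- Restriction of cocycles to a finer cover. -/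
def resCocycles {V W : PointedCover X} (h : V ≤ W) (n : ℕ) : cocycles A V n →+ cocycles A W n :=
  ((res h n).comp (cocycles A V n).subtype).codRestrict (cocycles A W n)
    fun c => res_mem_cocycles h n c.2

variable (A)

/-- The map induced on cohomology by passing to a finer cover. -/
def refine (n : ℕ) (V W : PointedCover X) (h : V ≤ W) :
    CoverCohomology A V n →+ CoverCohomology A W n :=
  QuotientAddGroup.map _ _ (resCocycles h n)
    (fun c hc => by
      rw [AddSubgroup.mem_comap, AddSubgroup.mem_addSubgroupOf]
      exact res_mem_coboundaries h n (AddSubgroup.mem_addSubgroupOf.1 hc))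

open Classical in
variable (X) in
/-- The Čech cohomology group `Ȟⁿ(X, A)` with coefficients in the sheaf of continuous `A`-valued
functions (for discrete `A`, the constant sheaf): the direct limit over open covers. -/
abbrev CechCohomology (n : ℕ) : Type _ :=
  AddCommGroup.DirectLimit (fun V : PointedCover X => CoverCohomology A V n) (refine A n)

variable {A}

open Classical in
/-- The class of a cocycle in `Ȟⁿ(X, A)`. -/
def cechClass {V : PointedCover X} {n : ℕ} (c : cocycles A V n) : CechCohomology X A n :=
  AddCommGroup.DirectLimit.of (fun V : PointedCover X => CoverCohomology A V n) (refine A n) V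
    (QuotientAddGroup.mk c)

/-- `t ↦ exp(2πit)`, from `ℝ` to `U(1)` (written additively). -/
def expTwoPi : C(ℝ, Additive Circle) :=
  ⟨fun t => Additive.ofMul (Circle.exp (2 * Real.pi * t)), by
    exact continuous_ofMul.comp (by fun_prop)⟩

/-- The inclusion `ℤ → ℝ`. -/
def intInclusion : C(ℤ, ℝ) :=
  ⟨fun n => (n : ℝ), continuous_of_discreteTopology⟩

/-- `c` is the image of `u` under the connecting homomorphism `Ȟ²(X, U(1)) → Ȟ³(X, ℤ)` of the
exponential sequence `0 → ℤ → ℝ → U(1) → 0`: on some cover, `u` is represented by a cocycle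
`g = exp(2πi f)` with `f` a continuous real cochain, and `c` by the integral cocycle `δf`. -/
def IsBockstein (u : CechCohomology X (Additive Circle) 2) (c : CechCohomology X ℤ 3) : Prop :=
  ∃ (V : PointedCover X) (f : Cochain ℝ V 2) (g : cocycles (Additive Circle) V 2)
    (n : cocycles ℤ V 3),
    (∀ i, g.1 i = expTwoPi.comp (f i)) ∧
    (∀ i, cechD ℝ V 2 f i = intInclusion.comp (n.1 i)) ∧
    cechClass g = u ∧ cechClass n = c

end Cech

/-! # The Fermi gerbe -/

section Lines

variable {H : Type*} [NormedAddCommGroup H] [InnerProductSpace ℂ H]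

/-- The span `E_{(a,b)}` of the eigenspaces of `A` for eigenvalues in the open interval `(a, b)`
(the zero space when `b ≤ a`). -/
def spectralSubspace (A : H →ₗ.[ℂ] H) (a b : ℝ) : Submodule ℂ H :=
  ⨆ t ∈ Ioo a b, eigenspace A t

/-- The determinant line `D(a, b)`: the top exterior power of `E_{(a,b)}`, realised inside the
exterior algebra of `H`. When `E_{(a,b)} = 0`, in particular when `b ≤ a`, this is the line of
scalars `ℂ · 1`. -/
def detLine (A : H →ₗ.[ℂ] H) (a b : ℝ) : Submodule ℂ (ExteriorAlgebra ℂ H) :=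
  Submodule.span ℂ (Set.range
    fun v : Fin (Module.finrank ℂ (spectralSubspace A a b)) → spectralSubspace A a b =>
      ExteriorAlgebra.ιMulti ℂ _ fun k => (v k : H))

/-- The fibre `L(a, b)` of the transition line bundle, written uniformly in `a` and `b` as
`Hom(D(b, a), D(a, b))`. One of the two determinant lines is always the line of scalars `ℂ · 1`,
so this is `D(a, b)` (by evaluation at `1`) when `a < b`, the dual of `D(b, a)` when `b < a`,
and `ℂ` when `a = b`. -/
abbrev line (A : H →ₗ.[ℂ] H) (a b : ℝ) : Type _ :=
  detLine A b a →ₗ[ℂ] detLine A a b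

/-- For `m ≤ a, b`, an element `f` of `L(a, b)` is the same as a linear map `D(m, a) → D(m, b)`,
namely `p ∧ q ↦ p ∧ f(q)` for `p ∈ D(m, min a b)` and `q ∈ D(b, a)`; that is, exterior
multiplication by an element of `D(a, b)` when `a ≤ b`, and contraction with an element of the
dual of `D(b, a)` when `b ≤ a`. `Acts A m f w w'` says that this map sends `w` to `w'`. -/
def Acts (A : H →ₗ.[ℂ] H) (m : ℝ) {a b : ℝ} (f : line A a b) (w w' : ExteriorAlgebra ℂ H) :
    Prop :=
  ∃ p ∈ detLine A m (min a b), ∃ q : detLine A b a,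
    w = p * (q : ExteriorAlgebra ℂ H) ∧ w' = p * (f q : ExteriorAlgebra ℂ H)

/-- `h = φ(f ⊗ g)` for the canonical isomorphism `φ : L(a, b) ⊗ L(b, c) → L(a, c)`. With
`m = min a b c`, it is the composition of maps `D(m, a) → D(m, b) → D(m, c)`. For `a < b < c` it
is the exterior product `D(a, b) ⊗ D(b, c) → D(a, c)`, and for `a = c` it is the pairing of a
line with its dual. -/
def IsProduct (A : H →ₗ.[ℂ] H) {a b c : ℝ} (f : line A a b) (g : line A b c) (h : line A a c) :
    Prop :=
  ∀ w ∈ detLine A (min a (min b c)) a, ∀ w' w'' : ExteriorAlgebra ℂ H,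
    Acts A (min a (min b c)) f w w' → Acts A (min a (min b c)) g w' w'' →
      Acts A (min a (min b c)) h w w''

/-- `e` is an orthonormal basis of the subspace `E`. -/
def IsOrthonormalFrame (E : Submodule ℂ H) {n : ℕ} (e : Fin n → H) : Prop :=
  Orthonormal ℂ e ∧ Submodule.span ℂ (Set.range e) = E

end Lines

section Gerbe

variable {X : Type*} [TopologicalSpace X]
  {H : Type*} [NormedAddCommGroup H] [InnerProductSpace ℂ H] [CompleteSpace H]

/-- The member `U_a = {x : a ∉ σ(F x)}` of the standard cover. -/
def standardOpen (F : X → CFsa H) (a : ℝ) : Set X :=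
  {x | a ∉ spectrum (F x).1}

/-- `s` is a continuous section of unit length, over the open set `W ⊆ U_a ∩ U_b`, of the
Hermitian line bundle with fibres `L(a, b)`. The determinant lines carry the topology and the
Hermitian metric for which `e₁ ∧ ⋯ ∧ eₙ` is a continuous unit section whenever `(e₁, …, eₙ)` is a
continuous family of orthonormal bases of the spectral subspaces. So, near each point of `W`, `s`
is required to map the local frame `e'₁ ∧ ⋯ ∧ e'ₘ` of `D(b, a)` to `c · e₁ ∧ ⋯ ∧ eₙ`, with
`c` a continuous `U(1)`-valued function. -/
def IsUnitSection (F : X → CFsa H) (a b : ℝ) (W : Set X) (s : ∀ x, line (F x).1 a b) : Prop :=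
  ∀ x₀ ∈ W, ∃ N ∈ 𝓝 x₀, ∃ (n m : ℕ) (e : X → Fin n → H) (e' : X → Fin m → H) (c : X → Circle),
    ContinuousOn e N ∧ ContinuousOn e' N ∧ ContinuousOn c N ∧
    ∀ x ∈ N, IsOrthonormalFrame (spectralSubspace (F x).1 a b) (e x) ∧
      IsOrthonormalFrame (spectralSubspace (F x).1 b a) (e' x) ∧
      ∀ q : detLine (F x).1 b a, (q : ExteriorAlgebra ℂ H) = ExteriorAlgebra.ιMulti ℂ m (e' x) →
        (s x q : ExteriorAlgebra ℂ H) = (c x : ℂ) • ExteriorAlgebra.ιMulti ℂ n (e x)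

/-- `u ∈ Ȟ²(X, U(1))` is the class of the Fermi gerbe of `F`. There are an open cover
`(V_i)` refining the standard cover, with `V_i ⊆ U_{ℓ i}` and `-1 < ℓ i < 1`, and continuous unit
sections `s_{ij}` of `L(ℓ i, ℓ j)` over `V_i ∩ V_j`, such that `u` is the class of the cocycle
`g` given by `φ(s_{ij} ⊗ s_{jk}) = g_{ijk} s_{ik}` on `V_i ∩ V_j ∩ V_k`. -/
def IsGerbeClass (F : X → CFsa H) (u : CechCohomology X (Additive Circle) 2) : Prop :=
  ∃ (V : PointedCover X) (ℓ : X → ℝ) (s : ∀ i j x, line (F x).1 (ℓ i) (ℓ j))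
    (g : cocycles (Additive Circle) V 2),
    (∀ i, ℓ i ∈ Ioo (-1 : ℝ) 1 ∧ (V.nhd i : Set X) ⊆ standardOpen F (ℓ i)) ∧
    (∀ i j, IsUnitSection F (ℓ i) (ℓ j) (V.nhd i ∩ V.nhd j : Set X) (s i j)) ∧
    (∀ (i j k : X) (x : V.inter ![i, j, k]),
      IsProduct (F x).1 (s i j x) (s j k x)
        (((g.1 ![i, j, k] x).toMul : ℂ) • s i k x)) ∧
    cechClass g = u

/-- `c ∈ Ȟ³(X, ℤ)` is the Dixmier–Douady invariant of the Fermi gerbe of `F`: the image of its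
class in `Ȟ²(X, U(1))` under the connecting homomorphism of the exponential sequence. -/
def IsDixmierDouadyInvariant (F : X → CFsa H) (c : CechCohomology X ℤ 3) : Prop :=
  ∃ u : CechCohomology X (Additive Circle) 2, IsGerbeClass F u ∧ IsBockstein u c

end Gerbe

end

end FermiGerbe

namespace FermiGerbe

open Set TopologicalSpace Topology Filter

/-! ### Orthonormal frames and determinant lines. -/

section Frames

variable {H : Type*} [NormedAddCommGroup H] [InnerProductSpace ℂ H]

/-! Since l₀ lies in every resolvent set, the line bundle L(l₀, a) is defined over all of U_a, and
the canonical isomorphisms L(l₀, a) ⊗ L(a, b) → L(l₀, b) trivialise the gerbe. In terms of cocycles: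
given V, ℓ, s, g, choose a unit section t_i of L(l₀, ℓ i) near the point i, shrink V_i to its
domain, and define the phase b_ij by t_i · s_ij = b_ij t_j. Associativity gives b_ij b_jk = g_ijk
b_ik, so g becomes a coboundary on the finer cover (`eq_zero_of_isGerbeClass`). The constant choice
ℓ = l₀ realises the class 0 (`isGerbeClass_zero`).

The order of l₀, ℓ i, ℓ j is arbitrary. Case distinctions are avoided by letting L(a, b) act as maps
D(m, a) → D(m, b) for a common lower bound m: products become compositions, and m is lowered by
exterior multiplication with a unit vector of D(m', m) (`IsTransition.of_le`, `IsProduct.acts`,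
`IsTransition.mul_eq`).

Existence and continuity of sections come from spectral theory. The map t ↦ 1/(t - a) carries (a, b)
to ((b - a)⁻¹, ∞), so E_(a,b) is the range of a spectral projection of the bounded operator (A -
a)⁻¹. This projection has finite rank because of the essential gap and is norm continuous in the gap
topology, which yields local orthonormal frames (`exists_continuousOn_frame_spectralSubspace`). Two
frames differ by a continuous unitary determinant (`IsUnitVolumeAt.exists_eq_smul`).

For the integral class, injectivity of the direct limit makes any representing U(1)-cocycle of class
0 a coboundary δb on some cover. On a paracompact Hausdorff space b lifts to a real cochain after
refinement; correcting the real lift of the cocycle by it leaves an integral cochain bounding the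
Bockstein cocycle (`eq_zero_of_isBockstein_zero`). -/

theorem IsOrthonormalFrame.exists_orthonormalBasis {E : Submodule ℂ H} {n : ℕ} {e : Fin n → H}
    (he : IsOrthonormalFrame E e) :
    ∃ b : OrthonormalBasis (Fin n) ℂ E, ∀ i, (b i : H) = e i := by
  obtain ⟨h1, rfl⟩ := he
  have h2 : Orthonormal ℂ fun i => (⟨e i, Submodule.subset_span ⟨i, rfl⟩⟩ :
      Submodule.span ℂ (range e)) := by
    rw [orthonormal_iff_ite] at h1 ⊢
    intro i j
    exact h1 i j
  refine ⟨OrthonormalBasis.mk h2 ?_, fun i => by rw [OrthonormalBasis.coe_mk]⟩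
  rintro ⟨x, hx⟩ -
  have h3 : x ∈ (Submodule.span ℂ (range fun i => (⟨e i, Submodule.subset_span ⟨i, rfl⟩⟩ :
      Submodule.span ℂ (range e)))).map (Submodule.subtype _) := by
    rw [Submodule.map_span, ← range_comp]
    exact hx
  obtain ⟨y, hy, hyx⟩ := h3
  have : y = ⟨x, hx⟩ := Subtype.ext hyx
  rwa [← this]

theorem IsOrthonormalFrame.mem {E : Submodule ℂ H} {n : ℕ} {e : Fin n → H}
    (he : IsOrthonormalFrame E e) (i : Fin n) : e i ∈ E :=
  he.2 ▸ Submodule.subset_span ⟨i, rfl⟩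

theorem IsOrthonormalFrame.finrank_eq {E : Submodule ℂ H} {n : ℕ} {e : Fin n → H}
    (he : IsOrthonormalFrame E e) : Module.finrank ℂ E = n := by
  rw [← he.2, finrank_span_eq_card he.1.linearIndependent, Fintype.card_fin]

/-- An alternating map of top degree on E is determined by its value on one basis. -/
theorem IsOrthonormalFrame.ιMulti_eq_det_smul {E : Submodule ℂ H} {n : ℕ} {e : Fin n → H}
    (he : IsOrthonormalFrame E e) {v : Fin n → H} (hv : ∀ i, v i ∈ E) :
    ExteriorAlgebra.ιMulti ℂ n v =
      (Matrix.of fun i j => inner ℂ (e i) (v j)).det • ExteriorAlgebra.ιMulti ℂ n e := by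
  obtain ⟨b, hb⟩ := he.exists_orthonormalBasis
  have key : (ExteriorAlgebra.ιMulti ℂ n).compLinearMap E.subtype =
      (LinearMap.toSpanSingleton ℂ _ (ExteriorAlgebra.ιMulti ℂ n e)).compAlternatingMap
        b.toBasis.det := by
    refine Module.Basis.ext_alternating b.toBasis fun i hi => ?_
    let σ : Equiv.Perm (Fin n) := Equiv.ofBijective i (Finite.injective_iff_bijective.1 hi)
    have h1 : (fun k => ((b.toBasis (i k) : E) : H)) = e ∘ σ := by
      funext k
      simp [hb, σ]
    have h2 : (fun k => b.toBasis (i k)) = b.toBasis ∘ σ := rfl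
    have h3 : (ExteriorAlgebra.ιMulti ℂ n).compLinearMap E.subtype (fun k => b.toBasis (i k)) =
      ExteriorAlgebra.ιMulti ℂ n (e ∘ σ) := by
      rw [← h1]; rfl
    rw [h3, LinearMap.compAlternatingMap_apply, h2, AlternatingMap.map_perm,
      AlternatingMap.map_perm, Module.Basis.det_self]
    rw [LinearMap.toSpanSingleton_apply, Units.smul_def, Units.smul_def, smul_assoc, one_smul]
  have h := congrArg (fun f => f fun i => (⟨v i, hv i⟩ : E)) key
  have h4 : (b.toBasis.det fun i => (⟨v i, hv i⟩ : E)) =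
      (Matrix.of fun i j => inner ℂ (e i) (v j)).det := by
    rw [Module.Basis.det_apply]
    congr 1
    ext i j
    rw [Module.Basis.toMatrix_apply, OrthonormalBasis.coe_toBasis_repr_apply,
      OrthonormalBasis.repr_apply_apply, Matrix.of_apply, ← hb]
    rfl
  simp only [LinearMap.compAlternatingMap_apply, h4, LinearMap.toSpanSingleton_apply] at h
  exact h

/-- The matrix of inner products is the unitary change of basis. -/
theorem IsOrthonormalFrame.norm_det_eq_one {E : Submodule ℂ H} {n : ℕ} {e v : Fin n → H}
    (he : IsOrthonormalFrame E e) (hv : IsOrthonormalFrame E v) :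
    ‖(Matrix.of fun i j => inner ℂ (e i) (v j)).det‖ = 1 := by
  obtain ⟨b, hb⟩ := he.exists_orthonormalBasis
  obtain ⟨b', hb'⟩ := hv.exists_orthonormalBasis
  rw [← b.det_to_matrix_orthonormalBasis b', Module.Basis.det_apply]
  congr 2
  ext i j
  rw [Module.Basis.toMatrix_apply, OrthonormalBasis.coe_toBasis_repr_apply,
      OrthonormalBasis.repr_apply_apply, Matrix.of_apply, ← hb, ← hb']
  rfl

/-- The Gram determinant against e extends to a linear functional on the exterior algebra taking the
value 1 on this vector. -/
theorem IsOrthonormalFrame.ιMulti_ne_zero {E : Submodule ℂ H} {n : ℕ} {e : Fin n → H}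
    (he : IsOrthonormalFrame E e) : ExteriorAlgebra.ιMulti ℂ n e ≠ 0 := by
  intro h0
  let T : H →ₗ[ℂ] (Fin n → ℂ) := LinearMap.pi fun i => (innerSL ℂ (e i)).toLinearMap
  let f : H [⋀^Fin n]→ₗ[ℂ] ℂ := Matrix.detRowAlternating.compLinearMap T
  -- `liftAlternating` needs a form in every degree; all but degree n are zero.
  let g : ∀ i, H [⋀^Fin i]→ₗ[ℂ] ℂ := Function.update 0 n f
  have h1 : ExteriorAlgebra.liftAlternating g (ExteriorAlgebra.ιMulti ℂ n e) = f e := by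
    rw [ExteriorAlgebra.liftAlternating_apply_ιMulti]
    simp [g]
  rw [h0, map_zero] at h1
  have h2 : f e = (1 : Matrix (Fin n) (Fin n) ℂ).det := by
    change (Matrix.of fun i j => inner ℂ (e j) (e i)).det = _
    congr 1
    ext i j
    rw [Matrix.of_apply, orthonormal_iff_ite.1 he.1, Matrix.one_apply]
    simp only [eq_comm]
  rw [h2, Matrix.det_one] at h1
  exact zero_ne_one h1

theorem mem_eigenspace_iff {A : H →ₗ.[ℂ] H} {t : ℝ} {v : H} :
    v ∈ eigenspace A t ↔ ∃ h : v ∈ A.domain, A ⟨v, h⟩ = (t : ℂ) • v := by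
  constructor
  · rintro ⟨u, hu, rfl⟩
    refine ⟨u.2, ?_⟩
    have := LinearMap.mem_ker.1 hu
    exact sub_eq_zero.1 this
  · rintro ⟨h, h'⟩
    exact ⟨⟨v, h⟩, LinearMap.mem_ker.2 (sub_eq_zero.2 h'), rfl⟩

theorem eigenspace_eq_bot_of_notMem_spectrum {A : H →ₗ.[ℂ] H} {t : ℝ} (ht : t ∉ spectrum A) :
    eigenspace A t = ⊥ := by
  obtain ⟨R, -, hR⟩ := not_not.1 ht
  rw [eq_bot_iff]
  intro v hv
  obtain ⟨h, h'⟩ := mem_eigenspace_iff.1 hv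
  have := hR ⟨v, h⟩
  rw [h', sub_self, map_zero] at this
  exact this.symm

theorem spectralSubspace_eq_bot {A : H →ₗ.[ℂ] H} {a b : ℝ} (h : b ≤ a) :
    spectralSubspace A a b = ⊥ := by
  simp [spectralSubspace, Ioo_eq_empty (not_lt.2 h)]

theorem isOrthonormalFrame_bot (e : Fin 0 → H) : IsOrthonormalFrame (⊥ : Submodule ℂ H) e := by
  refine ⟨⟨fun i => i.elim0, fun i => i.elim0⟩, ?_⟩
  rw [Set.range_eq_empty, Submodule.span_empty]

theorem detLine_eq_span {A : H →ₗ.[ℂ] H} {a b : ℝ} {n : ℕ} {e : Fin n → H}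
    (he : IsOrthonormalFrame (spectralSubspace A a b) e) :
    detLine A a b = Submodule.span ℂ {ExteriorAlgebra.ιMulti ℂ n e} := by
  obtain rfl := he.finrank_eq
  apply le_antisymm
  · refine Submodule.span_le.2 ?_
    rintro _ ⟨v, rfl⟩
    refine Submodule.mem_span_singleton.2 ⟨_, (he.ιMulti_eq_det_smul fun i => (v i).2).symm⟩
  · refine Submodule.span_le.2 (singleton_subset_iff.2 (Submodule.subset_span ?_))
    exact ⟨fun i => ⟨e i, he.mem i⟩, rfl⟩

/-- The interval (m, a) can be cut at b because b is not an eigenvalue; if a ≤ b there is nothing to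
cut and the second summand is zero. -/
theorem spectralSubspace_sup {A : H →ₗ.[ℂ] H} {m a b : ℝ} (hmb : m ≤ b)
    (hb : eigenspace A b = ⊥) :
    spectralSubspace A m (min a b) ⊔ spectralSubspace A b a = spectralSubspace A m a := by
  rcases le_total a b with hab | hab
  · rw [min_eq_left hab, spectralSubspace_eq_bot hab, sup_bot_eq]
  · rw [min_eq_right hab]
    apply le_antisymm
    · refine sup_le ?_ ?_
      · exact biSup_mono fun t ht => ⟨ht.1, ht.2.trans_le hab⟩
      · exact biSup_mono fun t ht => ⟨hmb.trans_lt ht.1, ht.2⟩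
    · refine iSup₂_le fun t ht => ?_
      rcases lt_trichotomy t b with h | rfl | h
      · exact le_sup_of_le_left (le_iSup₂_of_le t ⟨ht.1, h⟩ le_rfl)
      · rw [hb]; exact bot_le
      · exact le_sup_of_le_right (le_iSup₂_of_le t ⟨h, ht.2⟩ le_rfl)

theorem IsOrthonormalFrame.append {E E' : Submodule ℂ H} {n k : ℕ} {e : Fin n → H}
    {e' : Fin k → H} (he : IsOrthonormalFrame E e) (he' : IsOrthonormalFrame E' e')
    (h : E ⟂ E') : IsOrthonormalFrame (E ⊔ E') (Fin.append e e') := by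
  rw [Submodule.isOrtho_iff_inner_eq] at h
  refine ⟨?_, ?_⟩
  · have h1 := orthonormal_iff_ite.1 he.1
    have h2 := orthonormal_iff_ite.1 he'.1
    rw [orthonormal_iff_ite]
    intro i j
    induction i using Fin.addCases with
    | left i =>
      induction j using Fin.addCases with
      | left j => simp [h1]
      | right j =>
        rw [Fin.append_left, Fin.append_right, h _ (he.mem i) _ (he'.mem j), if_neg]
        intro hij
        have := congrArg Fin.val hij
        simp at this
        omega
    | right i =>
      induction j using Fin.addCases with
      | left j =>
        rw [Fin.append_left, Fin.append_right, inner_eq_zero_symm.1 (h _ (he.mem j) _ (he'.mem i)),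
          if_neg]
        intro hij
        have := congrArg Fin.val hij
        simp at this
        omega
      | right j => simp [h2]
  · have : range (Fin.append e e') = range e ∪ range e' := by
      ext v
      constructor
      · rintro ⟨i, rfl⟩
        induction i using Fin.addCases with
        | left i => exact Or.inl ⟨i, by simp⟩
        | right i => exact Or.inr ⟨i, by simp⟩
      · rintro (⟨i, rfl⟩ | ⟨i, rfl⟩)
        · exact ⟨Fin.castAdd k i, by simp⟩
        · exact ⟨Fin.natAdd n i, by simp⟩
    rw [this, Submodule.span_union, he.2, he'.2]

end Frames

/-! ### Orthogonality of spectral subspaces of a self-adjoint operator. -/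

section Symmetric

variable {H : Type*} [NormedAddCommGroup H] [InnerProductSpace ℂ H] [CompleteSpace H]

theorem inner_apply_eq_of_isSelfAdjoint {A : H →ₗ.[ℂ] H} (hA : IsSelfAdjoint A)
    (u v : A.domain) : inner ℂ (A u) (v : H) = inner ℂ (u : H) (A v) := by
  have h := LinearPMap.adjoint_isFormalAdjoint hA.dense_domain
  rw [LinearPMap.isSelfAdjoint_def.1 hA] at h
  exact h u v

theorem inner_eq_zero_of_mem_eigenspace {A : H →ₗ.[ℂ] H} (hA : IsSelfAdjoint A) {s t : ℝ}
    (hst : s ≠ t) {u v : H} (hu : u ∈ eigenspace A s) (hv : v ∈ eigenspace A t) :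
    inner ℂ u v = 0 := by
  obtain ⟨hu, hu'⟩ := mem_eigenspace_iff.1 hu
  obtain ⟨hv, hv'⟩ := mem_eigenspace_iff.1 hv
  have h := inner_apply_eq_of_isSelfAdjoint hA ⟨u, hu⟩ ⟨v, hv⟩
  rw [hu', hv', inner_smul_left, inner_smul_right, Complex.conj_ofReal] at h
  by_contra h0
  exact hst (Complex.ofReal_injective (mul_right_cancel₀ h0 h))

theorem isOrtho_spectralSubspace {A : H →ₗ.[ℂ] H} (hA : IsSelfAdjoint A) {a b c d : ℝ}
    (h : Disjoint (Ioo a b) (Ioo c d)) :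
    spectralSubspace A a b ⟂ spectralSubspace A c d := by
  simp only [spectralSubspace, Submodule.isOrtho_iSup_left, Submodule.isOrtho_iSup_right]
  intro s hs t ht
  rw [Submodule.isOrtho_iff_inner_eq]
  intro u hu v hv
  exact inner_eq_zero_of_mem_eigenspace hA (fun hst => Set.disjoint_left.1 h ht (by rwa [hst])) hu hv

theorem disjoint_Ioo_min {m a b : ℝ} : Disjoint (Ioo m (min a b)) (Ioo b a) := by
  rw [Set.disjoint_left]
  intro t ht ht'
  exact (ht.2.trans_le (min_le_right _ _)).not_gt ht'.1

theorem IsOrthonormalFrame.append_min {A : H →ₗ.[ℂ] H} (hA : IsSelfAdjoint A) {m a b : ℝ}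
    (hmb : m ≤ b) (hb : eigenspace A b = ⊥) {n k : ℕ} {e : Fin n → H}
    {e' : Fin k → H} (he : IsOrthonormalFrame (spectralSubspace A m (min a b)) e)
    (he' : IsOrthonormalFrame (spectralSubspace A b a) e') :
    IsOrthonormalFrame (spectralSubspace A m a) (Fin.append e e') := by
  rw [← spectralSubspace_sup hmb hb]
  exact he.append he' (isOrtho_spectralSubspace hA disjoint_Ioo_min)

end Symmetric

/-! ### Unit vectors of determinant lines and the action of L(a, b). -/

section Volume

variable {H : Type*} [NormedAddCommGroup H] [InnerProductSpace ℂ H]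

/-- `w` is a vector of length one in the determinant line `D(a, b)`. -/
def IsUnitVolume (A : H →ₗ.[ℂ] H) (a b : ℝ) (w : ExteriorAlgebra ℂ H) : Prop :=
  ∃ (n : ℕ) (e : Fin n → H) (c : Circle), IsOrthonormalFrame (spectralSubspace A a b) e ∧
    w = (c : ℂ) • ExteriorAlgebra.ιMulti ℂ n e

variable {A : H →ₗ.[ℂ] H} {a b m : ℝ} {w w' w'' p q : ExteriorAlgebra ℂ H}

theorem IsUnitVolume.ne_zero (hw : IsUnitVolume A a b w) : w ≠ 0 := by
  obtain ⟨n, e, c, he, rfl⟩ := hw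
  exact smul_ne_zero c.coe_ne_zero he.ιMulti_ne_zero

theorem IsUnitVolume.detLine_eq (hw : IsUnitVolume A a b w) :
    detLine A a b = Submodule.span ℂ {w} := by
  obtain ⟨n, e, c, he, rfl⟩ := hw
  rw [detLine_eq_span he, Submodule.span_singleton_smul_eq (IsUnit.mk0 _ c.coe_ne_zero)]

theorem IsUnitVolume.mem (hw : IsUnitVolume A a b w) : w ∈ detLine A a b := by
  rw [hw.detLine_eq]
  exact Submodule.mem_span_singleton_self w

theorem IsUnitVolume.exists_eq_smul (hw : IsUnitVolume A a b w) (hp : p ∈ detLine A a b) :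
    ∃ z : ℂ, p = z • w := by
  rw [hw.detLine_eq] at hp
  obtain ⟨z, rfl⟩ := Submodule.mem_span_singleton.1 hp
  exact ⟨z, rfl⟩

theorem Acts.smul_smul {f : line A a b} (h : Acts A m f w w') (z : ℂ) :
    Acts A m f (z • w) (z • w') := by
  obtain ⟨p, hp, q, rfl, rfl⟩ := h
  exact ⟨z • p, Submodule.smul_mem _ _ hp, q, by simp, by simp⟩

theorem Acts.const_smul {f : line A a b} (h : Acts A m f w w') (z : ℂ) :
    Acts A m (z • f) w (z • w') := by
  obtain ⟨p, hp, q, rfl, rfl⟩ := h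
  exact ⟨p, hp, q, rfl, by simp⟩

/-- Both factors range over lines, so two factorisations of w differ by scalars whose products agree
once p * q ≠ 0. Hence the relation `Acts` is a partial function. -/
theorem Acts.unique {f : line A a b} (h : Acts A m f w w') (h' : Acts A m f w w'')
    (hp : IsUnitVolume A m (min a b) p) (hq : IsUnitVolume A b a q) (hpq : p * q ≠ 0) :
    w' = w'' := by
  obtain ⟨p₁, hp₁, q₁, rfl, rfl⟩ := h
  obtain ⟨p₂, hp₂, q₂, hw, rfl⟩ := h'
  obtain ⟨y₁, rfl⟩ := hp.exists_eq_smul hp₁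
  obtain ⟨y₂, rfl⟩ := hp.exists_eq_smul hp₂
  obtain ⟨z₁, hz₁⟩ := hq.exists_eq_smul q₁.2
  obtain ⟨z₂, hz₂⟩ := hq.exists_eq_smul q₂.2
  have e₁ : q₁ = z₁ • (⟨q, hq.mem⟩ : detLine A b a) := Subtype.ext hz₁
  have e₂ : q₂ = z₂ • (⟨q, hq.mem⟩ : detLine A b a) := Subtype.ext hz₂
  rw [hz₁, hz₂] at hw
  simp only [smul_mul_smul_comm] at hw
  have h3 := smul_left_injective ℂ hpq hw
  rw [e₁, e₂]
  simp only [map_smul, Submodule.coe_smul, smul_mul_smul_comm, h3]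

end Volume

section Volume

variable {H : Type*} [NormedAddCommGroup H] [InnerProductSpace ℂ H] [CompleteSpace H]
  {A : H →ₗ.[ℂ] H} {a b m : ℝ} {w w' p q : ExteriorAlgebra ℂ H}

theorem IsUnitVolume.mul (hA : IsSelfAdjoint A)
    (hmb : m ≤ b) (hb : eigenspace A b = ⊥)
    (hp : IsUnitVolume A m (min a b) p) (hq : IsUnitVolume A b a q) :
    IsUnitVolume A m a (p * q) := by
  obtain ⟨n, e, c, he, rfl⟩ := hp
  obtain ⟨n', e', c', he', rfl⟩ := hq
  refine ⟨n + n', Fin.append e e', c * c', he.append_min hA hmb hb he', ?_⟩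
  rw [smul_mul_smul_comm, ExteriorAlgebra.ιMulti_mul_ιMulti, Circle.coe_mul]

/-- Lowering the base point from m to m': D(m', m) ∧ D(m, min a b) lies in D(m', min a b), and the
exterior product is associative. -/
theorem Acts.mul_left (hA : IsSelfAdjoint A) {m' : ℝ} {f : line A a b} (h : Acts A m f w w')
    (hm : m' ≤ m) (ha : m ≤ a) (hb : m ≤ b) (hm' : eigenspace A m = ⊥)
    (hp : IsUnitVolume A m' m p) (hq : IsUnitVolume A m (min a b) q) :
    Acts A m' f (p * w) (p * w') := by
  obtain ⟨p₁, hp₁, q₁, rfl, rfl⟩ := h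
  obtain ⟨z, rfl⟩ := hq.exists_eq_smul hp₁
  have h1 : IsUnitVolume A m' (min a b) (p * q) := by
    have hmin : min (min a b) m = m := min_eq_right (le_min ha hb)
    refine IsUnitVolume.mul hA hm hm' ?_ hq
    rwa [hmin]
  refine ⟨z • (p * q), Submodule.smul_mem _ _ h1.mem, q₁, ?_, ?_⟩ <;> simp [mul_assoc]

end Volume

/-! ### Spectral projections of a bounded self-adjoint operator. -/

section SpectralProjection

variable {H : Type*} [NormedAddCommGroup H] [InnerProductSpace ℂ H]

theorem continuousOn_indicator_Ioi (c : ℝ) :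
    ContinuousOn ((Ioi c).indicator (1 : ℝ → ℝ)) {c}ᶜ := by
  intro t ht
  apply ContinuousAt.continuousWithinAt
  rcases lt_or_gt_of_ne ht with h | h
  · have : (Ioi c).indicator (1 : ℝ → ℝ) =ᶠ[𝓝 t] fun _ => 0 := by
      filter_upwards [Iio_mem_nhds h] with s hs
      exact indicator_of_notMem (not_lt.2 (le_of_lt hs)) _
    exact this.continuousAt
  · have : (Ioi c).indicator (1 : ℝ → ℝ) =ᶠ[𝓝 t] fun _ => 1 := by
      filter_upwards [Ioi_mem_nhds h] with s hs
      exact indicator_of_mem hs _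
    exact this.continuousAt

theorem continuousOn_indicator_Ioi_spectrum {R : H →L[ℂ] H} {c : ℝ}
    (hc : c ∉ _root_.spectrum ℝ R) :
    ContinuousOn ((Ioi c).indicator (1 : ℝ → ℝ)) (_root_.spectrum ℝ R) :=
  (continuousOn_indicator_Ioi c).mono (by rintro t ht rfl; exact hc ht)

variable [CompleteSpace H]

/-- The spectral projection of a bounded self-adjoint operator for the interval `(c, ∞)`. -/
noncomputable def upperProjection (R : H →L[ℂ] H) (c : ℝ) : H →L[ℂ] H :=
  cfc ((Ioi c).indicator (1 : ℝ → ℝ)) R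

variable {R : H →L[ℂ] H} {c : ℝ}

/-- The function 1 - 1_(c,∞) is divisible by s - t among continuous functions on the spectrum, so 1
minus the projection factors through R - t, which kills v. -/
theorem upperProjection_apply_of_eigenvector (hR : IsSelfAdjoint R)
    (hc : c ∉ _root_.spectrum ℝ R) {t : ℝ} (ht : c < t) {v : H} (hv : R v = (t : ℂ) • v) :
    upperProjection R c v = v := by
  have h := continuousOn_indicator_Ioi_spectrum hc
  let f := (Ioi c).indicator (1 : ℝ → ℝ)
  -- The truncation at c keeps the denominator negative; it only alters points where the first
  -- factor vanishes.
  let g : ℝ → ℝ := fun s => (1 - f s) * (min s c - t)⁻¹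
  have hg : ContinuousOn g (_root_.spectrum ℝ R) := by
    refine (continuousOn_const.sub h).mul (ContinuousOn.inv₀ (by fun_prop) fun s _ => ?_)
    have := min_le_right s c
    exact (by linarith : min s c - t < 0).ne
  have h1 : (fun s => 1 - f s) = fun s => g s * (s - t) := by
    ext s
    by_cases hs : s ∈ Ioi c
    · simp [g, f, hs]
    · have hs' : s ≤ c := not_lt.1 hs
      have : s - t ≠ 0 := (by linarith : s - t < 0).ne
      simp [g, f, hs, min_eq_left hs', this]
  have h2 : cfc (fun s => 1 - f s) R = 1 - upperProjection R c := by
    rw [cfc_sub (fun _ => 1) f R continuousOn_const h, cfc_const 1 R, map_one]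
    rfl
  have h3 : cfc (fun s => g s * (s - t)) R = cfc g R * (R - algebraMap ℝ _ t) := by
    rw [cfc_mul g (fun s => s - t) R hg (by fun_prop), cfc_sub (fun s => s) (fun _ => t) R,
      cfc_id' ℝ R, cfc_const t R]
  have h4 : (R - algebraMap ℝ (H →L[ℂ] H) t) v = 0 := by
    rw [sub_apply, hv, Algebra.algebraMap_eq_smul_one]
    simp
  have h5 : (1 - upperProjection R c) v = 0 := by
    rw [← h2, h1, h3, mul_apply_eq_comp, h4, map_zero]
  rw [sub_apply, sub_eq_zero] at h5
  exact h5.symm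

/-- As c is not in the spectrum, this set equals the part in [c, ∞), hence is compact; an infinite
set would accumulate at a point that is isolated by hypothesis. -/
theorem finite_spectrum_inter_Ioi (hc : c ∉ _root_.spectrum ℝ R)
    (hiso : ∀ t ∈ _root_.spectrum ℝ R, c < t → ∀ᶠ s in 𝓝 t, s ∈ _root_.spectrum ℝ R → s = t) :
    (_root_.spectrum ℝ R ∩ Ioi c).Finite := by
  have h : _root_.spectrum ℝ R ∩ Ioi c = _root_.spectrum ℝ R ∩ Ici c := by
    ext t
    refine ⟨fun h => ⟨h.1, le_of_lt (mem_Ioi.1 h.2)⟩, fun h => ⟨h.1, lt_of_le_of_ne (mem_Ici.1 h.2) ?_⟩⟩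
    rintro rfl
    exact hc h.1
  have hK : IsCompact (_root_.spectrum ℝ R ∩ Ioi c) := by
    rw [h]
    exact (ContinuousFunctionalCalculus.isCompact_spectrum R).inter_right isClosed_Ici
  by_contra hinf
  obtain ⟨t, ht, hacc⟩ := Set.Infinite.exists_accPt_of_subset_isCompact hinf hK le_rfl
  rw [accPt_iff_frequently] at hacc
  obtain ⟨s, ⟨hs, hs'⟩, hs''⟩ := (hacc.and_eventually (hiso t ht.1 ht.2)).exists
  exact hs (hs'' hs'.1)

/-- On the spectrum the indicator of (c, ∞) is a finite sum of indicators of isolated points t. Each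
is continuous there and is annihilated by s - t, so the corresponding operator maps into the kernel
of R - t. -/
theorem upperProjection_apply_mem (hR : IsSelfAdjoint R) (hc : c ∉ _root_.spectrum ℝ R)
    (hiso : ∀ t ∈ _root_.spectrum ℝ R, c < t → ∀ᶠ s in 𝓝 t, s ∈ _root_.spectrum ℝ R → s = t)
    (v : H) : upperProjection R c v ∈ ⨆ t : ↥(_root_.spectrum ℝ R ∩ Ioi c),
      LinearMap.ker ((R - algebraMap ℝ (H →L[ℂ] H) t : H →L[ℂ] H) : H →ₗ[ℂ] H) := by
  have := (finite_spectrum_inter_Ioi hc hiso).fintype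
  classical
  have hcont : ∀ t : ↥(_root_.spectrum ℝ R ∩ Ioi c),
      ContinuousOn (fun s : ℝ => if s = t then (1 : ℝ) else 0) (_root_.spectrum ℝ R) := by
    intro t s hs
    by_cases hst : s = t
    · have h1 : (fun s : ℝ => if s = t then (1 : ℝ) else 0)
          =ᶠ[𝓝[_root_.spectrum ℝ R] s] fun _ => 1 := by
        rw [hst]
        filter_upwards [nhdsWithin_le_nhds (hiso t t.2.1 t.2.2), self_mem_nhdsWithin] with r hr hr'
        rw [if_pos (hr hr')]
      exact (continuousWithinAt_const (b := (1 : ℝ))).congr_of_eventuallyEq h1 (by simp [hst])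
    · have h1 : (fun s : ℝ => if s = t then (1 : ℝ) else 0) =ᶠ[𝓝 s] fun _ => 0 := by
        filter_upwards [isOpen_ne.mem_nhds hst] with r hr
        rw [if_neg hr]
      exact h1.continuousAt.continuousWithinAt
  have hsum : upperProjection R c = ∑ t : ↥(_root_.spectrum ℝ R ∩ Ioi c),
      cfc (fun s : ℝ => if s = t then (1 : ℝ) else 0) R := by
    rw [← cfc_sum_univ _ R hcont]
    refine cfc_congr fun s hs => ?_
    rw [Finset.sum_apply]
    by_cases hsc : s ∈ Ioi c
    · rw [indicator_of_mem hsc, Finset.sum_eq_single ⟨s, hs, hsc⟩]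
      · simp
      · intro t _ ht
        rw [if_neg]
        rintro rfl
        exact ht rfl
      · simp
    · rw [indicator_of_notMem hsc, Finset.sum_eq_zero]
      intro t _
      rw [if_neg]
      rintro rfl
      exact hsc t.2.2
  rw [hsum, sum_apply]
  refine Submodule.sum_mem _ fun t _ => Submodule.mem_iSup_of_mem t ?_
  rw [LinearMap.mem_ker, ContinuousLinearMap.coe_coe, ← mul_apply_eq_comp]
  have h3 : cfc (fun s : ℝ => (s - t) * if s = t then (1 : ℝ) else 0) R =
      (R - algebraMap ℝ _ (t : ℝ)) * cfc (fun s : ℝ => if s = t then (1 : ℝ) else 0) R := by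
    rw [cfc_mul (fun s : ℝ => s - t) _ R (by fun_prop) (hcont t),
      cfc_sub (fun s => s) (fun _ => (t : ℝ)) R, cfc_id' ℝ R, cfc_const (t : ℝ) R]
  have h4 : (fun s : ℝ => (s - t) * if s = t then (1 : ℝ) else 0) = 0 := by
    ext s
    by_cases hs : s = t <;> simp [hs]
  rw [← h3, h4, cfc_zero, zero_apply]

/-- Continuity of the functional calculus in the operator: one function, continuous on the open set
{c}ᶜ, serves all the spectra. -/
theorem continuousOn_upperProjection {X : Type*} [TopologicalSpace X] {R : X → H →L[ℂ] H}
    {t : Set X} (hR : ContinuousOn R t) (hsa : ∀ x ∈ t, IsSelfAdjoint (R x))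
    (hc : ∀ x ∈ t, c ∉ _root_.spectrum ℝ (R x)) :
    ContinuousOn (fun x => upperProjection (R x) c) t := by
  refine ContinuousOn.cfc_of_mem_nhdsSet (s := {c}ᶜ) _ ?_ hR hsa (continuousOn_indicator_Ioi c)
  refine isOpen_compl_singleton.mem_nhdsSet.2 (iUnion₂_subset fun x hx s hs => ?_)
  rintro rfl
  exact hc x hx hs

end SpectralProjection

/-! ### Local frames from a continuous family of projections. -/

section LocalFrame

variable {H : Type*} [NormedAddCommGroup H] [InnerProductSpace ℂ H]
  {X : Type*} [TopologicalSpace X]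

theorem continuousOn_gramSchmidt {n : ℕ} {v : X → Fin n → H} {t : Set X}
    (hv : ContinuousOn v t) (hli : ∀ x ∈ t, LinearIndependent ℂ (v x)) (i : Fin n) :
    ContinuousOn (fun x => InnerProductSpace.gramSchmidt ℂ (v x) i) t := by
  induction i using WellFoundedLT.induction with
  | ind i ih =>
    have h : (fun x => InnerProductSpace.gramSchmidt ℂ (v x) i) = fun x => v x i -
        ∑ j ∈ Finset.Iio i, (inner ℂ (InnerProductSpace.gramSchmidt ℂ (v x) j) (v x i) /
          (‖InnerProductSpace.gramSchmidt ℂ (v x) j‖ : ℂ) ^ 2) •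
            InnerProductSpace.gramSchmidt ℂ (v x) j := by
      ext x
      conv_rhs => rw [InnerProductSpace.gramSchmidt_def'' ℂ (v x) i]
      rw [← InnerProductSpace.gramSchmidt_def'' ℂ (v x) i]
      exact eq_sub_of_add_eq (InnerProductSpace.gramSchmidt_def'' ℂ (v x) i).symm
    rw [h]
    have hvi : ContinuousOn (fun x => v x i) t := continuousOn_pi.1 hv i
    refine hvi.sub (continuousOn_finsetSum _ fun j hj => ?_)
    have hj := ih j (Finset.mem_Iio.1 hj)
    refine ((hj.inner hvi).div (by fun_prop) fun x hx => ?_).smul hj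
    have := InnerProductSpace.gramSchmidt_ne_zero j (hli x hx)
    simpa using this

theorem continuousOn_gramSchmidtNormed {n : ℕ} {v : X → Fin n → H} {t : Set X}
    (hv : ContinuousOn v t) (hli : ∀ x ∈ t, LinearIndependent ℂ (v x)) :
    ContinuousOn (fun x => InnerProductSpace.gramSchmidtNormed ℂ (v x)) t := by
  refine continuousOn_pi.2 fun i => ?_
  have h := continuousOn_gramSchmidt hv hli i
  unfold InnerProductSpace.gramSchmidtNormed
  refine ContinuousOn.smul (ContinuousOn.inv₀ (by fun_prop) fun x hx => ?_) h
  have := InnerProductSpace.gramSchmidt_ne_zero i (hli x hx)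
  simpa using this

/-- Project an orthonormal basis of E x₀ by P x and apply Gram–Schmidt. The projected vectors stay
independent near x₀, and norm closeness of P x to P x₀ makes them span. -/
theorem exists_continuousOn_frame {P : X → H →L[ℂ] H} {E : X → Submodule ℂ H} {t : Set X}
    (ht : IsOpen t) (hP : ContinuousOn P t) (hE : ∀ x ∈ t, ∀ v, P x v ∈ E x)
    (hE' : ∀ x ∈ t, ∀ v ∈ E x, P x v = v) (hfin : ∀ x ∈ t, FiniteDimensional ℂ (E x))
    {x₀ : X} (hx₀ : x₀ ∈ t) :
    ∃ N ∈ 𝓝 x₀, ∃ (n : ℕ) (e : X → Fin n → H), ContinuousOn e N ∧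
      ∀ x ∈ N, IsOrthonormalFrame (E x) (e x) := by
  have := hfin x₀ hx₀
  let n := Module.finrank ℂ (E x₀)
  let b := stdOrthonormalBasis ℂ (E x₀)
  let v : X → Fin n → H := fun x i => P x (b i)
  have hv : ContinuousOn v t := continuousOn_pi.2 fun i => hP.clm_apply continuousOn_const
  have hv₀ : LinearIndependent ℂ (v x₀) := by
    have : v x₀ = fun i => (b i : H) := funext fun i => hE' x₀ hx₀ _ (b i).2
    rw [this]
    have h := b.toBasis.linearIndependent.map' (E x₀).subtype (Submodule.ker_subtype _)
    rwa [b.coe_toBasis] at h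
  let N : Set X := {x | x ∈ t ∧ LinearIndependent ℂ (v x) ∧ ‖P x - P x₀‖ < 1}
  have hN : N ∈ 𝓝 x₀ := by
    have h1 : ∀ᶠ x in 𝓝 x₀, LinearIndependent ℂ (v x) :=
      (hv.continuousAt (ht.mem_nhds hx₀)).eventually
        (isOpen_setOfPred_linearIndependent.mem_nhds hv₀)
    have h2 : ∀ᶠ x in 𝓝 x₀, ‖P x - P x₀‖ < 1 := by
      have h3 : ContinuousAt (fun x => ‖P x - P x₀‖) x₀ :=
        ((hP.continuousAt (ht.mem_nhds hx₀)).sub continuousAt_const).norm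
      refine h3.eventually (gt_mem_nhds ?_)
      simp
    filter_upwards [ht.mem_nhds hx₀, h1, h2] with x a b c using ⟨a, b, c⟩
  refine ⟨N, hN, n, fun x => InnerProductSpace.gramSchmidtNormed ℂ (v x),
    continuousOn_gramSchmidtNormed (hv.mono fun x hx => hx.1) fun x hx => hx.2.1,
    fun x ⟨hx, hli, hnorm⟩ => ⟨InnerProductSpace.gramSchmidtNormed_orthonormal hli, ?_⟩⟩
  rw [InnerProductSpace.span_gramSchmidtNormed_range, InnerProductSpace.span_gramSchmidt]
  have := hfin x hx
  refine Submodule.eq_of_le_of_finrank_le ?_ ?_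
  · refine Submodule.span_le.2 ?_
    rintro _ ⟨i, rfl⟩
    exact hE x hx _
  · rw [finrank_span_eq_card hli, Fintype.card_fin]
    -- P x₀ is injective on E x: a vector u in its kernel satisfies u = (P x - P x₀) u with ‖P x - P
    -- x₀‖ < 1. So dim E x ≤ n.
    let T : E x →ₗ[ℂ] E x₀ :=
      (((P x₀ : H →L[ℂ] H) : H →ₗ[ℂ] H) ∘ₗ (E x).subtype).codRestrict (E x₀) fun u => hE x₀ hx₀ _
    refine LinearMap.finrank_le_finrank_of_injective (f := T) ?_
    rw [← LinearMap.ker_eq_bot, LinearMap.ker_eq_bot']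
    intro u hu
    have h1 : P x₀ u = 0 := congrArg Subtype.val hu
    have h2 : (P x - P x₀) u = u := by rw [sub_apply, h1, sub_zero, hE' x hx _ u.2]
    have h3 := (P x - P x₀).le_opNorm u
    rw [h2] at h3
    by_contra h0
    have h4 : 0 < ‖(u : H)‖ := norm_pos_iff.2 fun h => h0 (Subtype.ext h)
    nlinarith

end LocalFrame

/-! ### Resolvent identities and the spectrum of the resolvent. -/

section Resolvent

variable {H : Type*} [NormedAddCommGroup H] [InnerProductSpace ℂ H]
  {A : H →ₗ.[ℂ] H} {z w : ℂ} {R Q : H →L[ℂ] H}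

theorem IsResolventAt.sub_eq (hR : IsResolventAt A z R) (hQ : IsResolventAt A w Q) :
    Q - R = (w - z) • (R * Q) := by
  ext v
  obtain ⟨h, hv⟩ := hQ.1 v
  have h1 := hR.2 ⟨Q v, h⟩
  have h2 : A ⟨Q v, h⟩ - z • Q v = v + (w - z) • Q v := by
    nth_rewrite 3 [← hv]
    module
  simp only at h1
  rw [h2, map_add, map_smul] at h1
  rw [sub_apply, ← h1]
  simp

theorem IsResolventAt.unique (hR : IsResolventAt A z R) (hQ : IsResolventAt A z Q) : R = Q := by
  have h := hR.sub_eq hQ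
  rw [sub_self, zero_smul, sub_eq_zero] at h
  exact h.symm

theorem IsResolventAt.resolvent_eq (hR : IsResolventAt A z R) : resolvent A z = R := by
  have h : ∃ R, IsResolventAt A z R := ⟨R, hR⟩
  rw [resolvent, dif_pos h]
  exact h.choose_spec.unique hR

theorem isResolventAt_resolvent (h : ∃ R, IsResolventAt A z R) :
    IsResolventAt A z (resolvent A z) := by
  obtain ⟨R, hR⟩ := h
  rwa [hR.resolvent_eq]

theorem IsResolventAt.mul_inverse (hR : IsResolventAt A z R)
    (h : IsUnit (1 - (w - z) • R)) :
    IsResolventAt A w (R * Ring.inverse (1 - (w - z) • R)) := by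
  set S := Ring.inverse (1 - (w - z) • R)
  have h1 : (1 - (w - z) • R) * S = 1 := Ring.mul_inverse_cancel _ h
  have h2 : S * (1 - (w - z) • R) = 1 := Ring.inverse_mul_cancel _ h
  have h3 : R * S = S * R := by
    have h4 : (1 - (w - z) • R) * R = R * (1 - (w - z) • R) := by
      simp only [sub_mul, mul_sub, one_mul, mul_one, smul_mul_assoc, mul_smul_comm]
    calc R * S = S * (1 - (w - z) • R) * R * S := by rw [h2, one_mul]
      _ = S * R * ((1 - (w - z) • R) * S) := by rw [mul_assoc S, h4]; simp only [mul_assoc]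
      _ = S * R := by rw [h1, mul_one]
  constructor
  · intro v
    obtain ⟨hd, hv⟩ := hR.1 (S v)
    refine ⟨hd, ?_⟩
    have h4 := congrArg (fun T : H →L[ℂ] H => T v) h1
    simp only [mul_apply_eq_comp, sub_apply, smul_apply,
      one_apply_eq_self] at h4
    have h5 : A ⟨R (S v), hd⟩ = S v + z • R (S v) := sub_eq_iff_eq_add.1 hv
    change A ⟨R (S v), hd⟩ - w • R (S v) = v
    calc A ⟨R (S v), hd⟩ - w • R (S v) = S v - (w - z) • R (S v) := by rw [h5]; module
      _ = v := h4
  · intro u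
    have h4 := congrArg (fun T : H →L[ℂ] H => T u) h2
    simp only [mul_apply_eq_comp, sub_apply, smul_apply,
      one_apply_eq_self] at h4
    have h5 : A u - w • (u : H) = (A u - z • (u : H)) - (w - z) • (u : H) := by module
    rw [h3, mul_apply_eq_comp, h5, map_sub R, hR.2 u, map_smul]
    exact h4

/-- The inverse is 1 + (w - z) Q, by the first resolvent identity in both orders. -/
theorem IsResolventAt.isUnit (hR : IsResolventAt A z R) (hQ : IsResolventAt A w Q) :
    IsUnit (1 - (w - z) • R) := by
  have h1 := hR.sub_eq hQ
  have h2 := hQ.sub_eq hR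
  refine ⟨⟨1 - (w - z) • R, 1 + (w - z) • Q, ?_, ?_⟩, rfl⟩
  · have : (1 - (w - z) • R) * (1 + (w - z) • Q) =
      1 + (w - z) • ((Q - R) - (w - z) • (R * Q)) := by
      simp only [sub_mul, mul_add, mul_one, one_mul, smul_mul_assoc, mul_smul_comm]
      module
    rw [this, h1, sub_self, smul_zero, add_zero]
  · have : (1 + (w - z) • Q) * (1 - (w - z) • R) =
      1 - (w - z) • ((R - Q) - (z - w) • (Q * R)) := by
      simp only [add_mul, mul_sub, mul_one, one_mul, smul_mul_assoc, mul_smul_comm]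
      module
    rw [this, h2, sub_self, smul_zero, sub_zero]

theorem IsResolventAt.notMem_spectrum_iff {t : ℝ} (hR : IsResolventAt A z R) :
    t ∉ spectrum A ↔ IsUnit (1 - ((t : ℂ) - z) • R) :=
  ⟨fun h => hR.isUnit (not_not.1 h).choose_spec, fun h => not_not.2 ⟨_, hR.mul_inverse h⟩⟩

theorem IsResolventAt.mem_eigenspace_iff {a t : ℝ} (hR : IsResolventAt A a R) {v : H} :
    v ∈ eigenspace A t ↔ ((t : ℂ) - a) • R v = v := by
  rw [FermiGerbe.mem_eigenspace_iff]
  constructor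
  · rintro ⟨h, hv⟩
    have h1 := hR.2 ⟨v, h⟩
    rw [hv, ← sub_smul, map_smul] at h1
    exact h1
  · intro hv
    obtain ⟨h, h1⟩ := hR.1 v
    have h2 : v ∈ A.domain := by
      rw [← hv]
      exact A.domain.smul_mem _ h
    refine ⟨h2, ?_⟩
    have h3 : (⟨v, h2⟩ : A.domain) = ((t : ℂ) - a) • ⟨R v, h⟩ := Subtype.ext hv.symm
    have h4 : A ⟨R v, h⟩ = v + (a : ℂ) • R v := by
      nth_rewrite 2 [← h1]
      module
    rw [h3, LinearPMap.map_smul, h4, smul_add, smul_comm _ (a : ℂ), hv]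
    module

theorem mem_real_spectrum_iff {R : H →L[ℂ] H} {r : ℝ} (hr : r ≠ 0) :
    r ∈ _root_.spectrum ℝ R ↔ ¬ IsUnit (1 - ((r⁻¹ : ℝ) : ℂ) • R) := by
  rw [_root_.spectrum.mem_iff]
  have h : algebraMap ℝ (H →L[ℂ] H) r - R = (r : ℂ) • (1 - ((r⁻¹ : ℝ) : ℂ) • R) := by
    rw [smul_sub, smul_smul, ← Complex.ofReal_mul, mul_inv_cancel₀ hr, Complex.ofReal_one, one_smul,
      Algebra.algebraMap_eq_smul_one]
    congr 1
  have hr' : (r : ℂ) ≠ 0 := by exact_mod_cast hr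
  rw [h]
  exact not_congr (isUnit_smul_iff (Units.mk0 (r : ℂ) hr') _)

/-- Spectral mapping for r ↦ a + 1/r: up to the factor r, the operator r - R is 1 - r⁻¹ R, the
operator that tests invertibility of A - (a + r⁻¹). -/
theorem IsResolventAt.mem_real_spectrum_iff {a r : ℝ} (hr : r ≠ 0) (hR : IsResolventAt A a R) :
    r ∈ _root_.spectrum ℝ R ↔ a + r⁻¹ ∈ spectrum A := by
  rw [FermiGerbe.mem_real_spectrum_iff hr, ← not_iff_not, not_not, hR.notMem_spectrum_iff]
  simp

variable [CompleteSpace H]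

theorem IsResolventAt.isSelfAdjoint {a : ℝ} (hA : IsSelfAdjoint A) (hR : IsResolventAt A a R) :
    IsSelfAdjoint R := by
  rw [ContinuousLinearMap.isSelfAdjoint_iff_isSymmetric]
  intro u v
  obtain ⟨hu, hu'⟩ := hR.1 u
  obtain ⟨hv, hv'⟩ := hR.1 v
  change inner ℂ (R u) v = inner ℂ u (R v)
  have h := inner_apply_eq_of_isSelfAdjoint hA ⟨R u, hu⟩ ⟨R v, hv⟩
  simp only at h
  nth_rewrite 2 [← hu']
  nth_rewrite 1 [← hv']
  rw [inner_sub_left, inner_sub_right, h, inner_smul_left, inner_smul_right, Complex.conj_ofReal]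

/-- The resolvent at the real point a is bounded and self-adjoint, so the non-real number (z - a)⁻¹
is outside its spectrum. Applied at z = -i, this makes the operator defining the gap topology a true
inverse and not the junk value. -/
theorem exists_isResolventAt_of_im_ne_zero {a : ℝ} (hA : IsSelfAdjoint A) (ha : a ∉ spectrum A)
    (hz : z.im ≠ 0) : ∃ Q, IsResolventAt A z Q := by
  obtain ⟨R, hR⟩ := not_not.1 ha
  refine ⟨_, hR.mul_inverse ?_⟩
  have h1 : z - a ≠ 0 := fun h => hz (by simpa using congrArg Complex.im h)
  have h2 : (z - a)⁻¹ ∉ _root_.spectrum ℂ R := by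
    intro h
    have h3 := (hR.isSelfAdjoint hA).im_eq_zero_of_mem_spectrum h
    rw [Complex.inv_im, div_eq_zero_iff, neg_eq_zero] at h3
    rcases h3 with h3 | h3
    · exact hz (by simpa using h3)
    · exact h1 (Complex.normSq_eq_zero.1 h3)
  rw [_root_.spectrum.notMem_iff] at h2
  have h : 1 - (z - a) • R = (z - a) • (algebraMap ℂ (H →L[ℂ] H) (z - a)⁻¹ - R) := by
    rw [smul_sub, Algebra.algebraMap_eq_smul_one, smul_smul, mul_inv_cancel₀ h1, one_smul]
  rw [h]
  exact (isUnit_smul_iff (Units.mk0 (z - a) h1) _).2 h2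

end Resolvent

/-! ### Spectral subspaces inside the essential gap. -/

section SpectralGap

variable {H : Type*} [NormedAddCommGroup H] [InnerProductSpace ℂ H]
  {A : H →ₗ.[ℂ] H} {a b : ℝ}

theorem inv_sub_notMem_spectrum_resolvent (ha : a ∉ spectrum A) (hb : b ∉ spectrum A)
    (hab : a < b) : (b - a)⁻¹ ∉ _root_.spectrum ℝ (resolvent A a) := by
  have hR := isResolventAt_resolvent (not_not.1 ha)
  have h : (b - a)⁻¹ ≠ 0 := inv_ne_zero (sub_pos.2 hab).ne'
  rw [hR.mem_real_spectrum_iff h, inv_inv, add_sub_cancel]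
  exact hb

theorem add_inv_mem_Ioo {t : ℝ} (hab : a < b) (ht : (b - a)⁻¹ < t) : a + t⁻¹ ∈ Ioo a b := by
  have h0 : 0 < (b - a)⁻¹ := inv_pos.2 (sub_pos.2 hab)
  have h1 : t⁻¹ < b - a := inv_lt_of_inv_lt₀ (sub_pos.2 hab) ht
  have h2 : 0 < t⁻¹ := inv_pos.2 (h0.trans ht)
  constructor <;> linarith

theorem mem_discreteSpectrum_of_gap (hgap : Disjoint (Ioo (-1 : ℝ) 1) (essentialSpectrum A))
    {t : ℝ} (ht : t ∈ Ioo (-1 : ℝ) 1) (h : t ∈ spectrum A) : t ∈ discreteSpectrum A := by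
  by_contra h'
  exact Set.disjoint_left.1 hgap ht ⟨h, h'⟩

theorem ker_resolvent_sub_eq {t : ℝ} (ha : a ∉ spectrum A) (ht : t ≠ 0) :
    LinearMap.ker ((resolvent A a - algebraMap ℝ (H →L[ℂ] H) t : H →L[ℂ] H) : H →ₗ[ℂ] H) =
      eigenspace A (a + t⁻¹) := by
  have hR := isResolventAt_resolvent (not_not.1 ha)
  have ht' : (t : ℂ) ≠ 0 := by exact_mod_cast ht
  ext v
  rw [LinearMap.mem_ker, hR.mem_eigenspace_iff, ContinuousLinearMap.coe_coe, sub_apply,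
    sub_eq_zero, Algebra.algebraMap_eq_smul_one]
  push_cast
  rw [add_sub_cancel_left, inv_smul_eq_iff₀ ht']
  rfl

theorem add_inv_mem_discreteSpectrum
    (hgap : Disjoint (Ioo (-1 : ℝ) 1) (essentialSpectrum A)) (ha : a ∈ Ioo (-1 : ℝ) 1)
    (hb : b ∈ Ioo (-1 : ℝ) 1) (ha' : a ∉ spectrum A) (hab : a < b)
    {t : ℝ} (ht : t ∈ _root_.spectrum ℝ (resolvent A a)) (hct : (b - a)⁻¹ < t) :
    a + t⁻¹ ∈ discreteSpectrum A := by
  have hR := isResolventAt_resolvent (not_not.1 ha')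
  have h0 : 0 < (b - a)⁻¹ := inv_pos.2 (sub_pos.2 hab)
  have h1 := add_inv_mem_Ioo hab hct
  refine mem_discreteSpectrum_of_gap hgap ⟨ha.1.trans h1.1, h1.2.trans hb.2⟩ ?_
  exact (hR.mem_real_spectrum_iff (h0.trans hct).ne').1 ht

/-- Points above (b - a)⁻¹ correspond under t ↦ a + 1/t to points of the gap, where the spectrum of
A is discrete; isolation pulls back along this continuous injective map. -/
theorem eventually_eq_of_mem_spectrum_resolvent
    (hgap : Disjoint (Ioo (-1 : ℝ) 1) (essentialSpectrum A)) (ha : a ∈ Ioo (-1 : ℝ) 1)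
    (hb : b ∈ Ioo (-1 : ℝ) 1) (ha' : a ∉ spectrum A) (hab : a < b)
    (t : ℝ) (ht : t ∈ _root_.spectrum ℝ (resolvent A a)) (hct : (b - a)⁻¹ < t) :
    ∀ᶠ s in 𝓝 t, s ∈ _root_.spectrum ℝ (resolvent A a) → s = t := by
  have hR := isResolventAt_resolvent (not_not.1 ha')
  have h0 : 0 < t := (inv_pos.2 (sub_pos.2 hab)).trans hct
  obtain ⟨-, ⟨ε, hε, hiso⟩, -⟩ := add_inv_mem_discreteSpectrum hgap ha hb ha' hab ht hct
  have hcont : ContinuousAt (fun s : ℝ => |a + s⁻¹ - (a + t⁻¹)|) t :=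
    ((continuousAt_const.add (continuousAt_inv₀ h0.ne')).sub continuousAt_const).abs
  have h1 : ∀ᶠ s in 𝓝 t, |a + s⁻¹ - (a + t⁻¹)| < ε :=
    hcont.eventually (gt_mem_nhds (by simpa using hε))
  filter_upwards [h1, lt_mem_nhds h0] with s hs hs0 hmem
  have := hiso _ ((hR.mem_real_spectrum_iff hs0.ne').1 hmem) hs
  exact inv_injective (add_left_cancel this)

variable [CompleteSpace H]

theorem upperProjection_mem_iSup_eigenspace (hA : IsSelfAdjoint A)
    (hgap : Disjoint (Ioo (-1 : ℝ) 1) (essentialSpectrum A)) (ha : a ∈ Ioo (-1 : ℝ) 1)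
    (hb : b ∈ Ioo (-1 : ℝ) 1) (ha' : a ∉ spectrum A) (hb' : b ∉ spectrum A) (hab : a < b) (v : H) :
    upperProjection (resolvent A a) (b - a)⁻¹ v ∈
      ⨆ t : ↥(_root_.spectrum ℝ (resolvent A a) ∩ Ioi (b - a)⁻¹), eigenspace A (a + (t : ℝ)⁻¹) := by
  have hR := isResolventAt_resolvent (not_not.1 ha')
  have h := upperProjection_apply_mem (hR.isSelfAdjoint hA)
    (inv_sub_notMem_spectrum_resolvent ha' hb' hab)
    (eventually_eq_of_mem_spectrum_resolvent hgap ha hb ha' hab) v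
  have h0 : 0 < (b - a)⁻¹ := inv_pos.2 (sub_pos.2 hab)
  convert h using 3 with t
  exact (ker_resolvent_sub_eq ha' (h0.trans t.2.2).ne').symm

theorem upperProjection_mem_spectralSubspace (hA : IsSelfAdjoint A)
    (hgap : Disjoint (Ioo (-1 : ℝ) 1) (essentialSpectrum A)) (ha : a ∈ Ioo (-1 : ℝ) 1)
    (hb : b ∈ Ioo (-1 : ℝ) 1) (ha' : a ∉ spectrum A) (hb' : b ∉ spectrum A) (hab : a < b) (v : H) :
    upperProjection (resolvent A a) (b - a)⁻¹ v ∈ spectralSubspace A a b := by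
  have h := upperProjection_mem_iSup_eigenspace hA hgap ha hb ha' hb' hab v
  refine (iSup_le fun t => ?_ : _ ≤ spectralSubspace A a b) h
  exact le_iSup₂_of_le (a + (t : ℝ)⁻¹) (add_inv_mem_Ioo hab t.2.2) le_rfl

theorem upperProjection_apply_of_mem_spectralSubspace (hA : IsSelfAdjoint A)
    (ha' : a ∉ spectrum A) (hb' : b ∉ spectrum A) (hab : a < b) {v : H}
    (hv : v ∈ spectralSubspace A a b) :
    upperProjection (resolvent A a) (b - a)⁻¹ v = v := by
  have hR := isResolventAt_resolvent (not_not.1 ha')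
  have h : spectralSubspace A a b ≤ LinearMap.eqLocus
      ((upperProjection (resolvent A a) (b - a)⁻¹ : H →L[ℂ] H) : H →ₗ[ℂ] H) LinearMap.id := by
    refine iSup₂_le fun t ht u hu => ?_
    have h0 : 0 < t - a := sub_pos.2 ht.1
    refine upperProjection_apply_of_eigenvector (t := (t - a)⁻¹) (hR.isSelfAdjoint hA)
      (inv_sub_notMem_spectrum_resolvent ha' hb' hab) ?_ ?_
    · exact inv_strictAnti₀ h0 (by linarith [ht.2])
    · have h1 := hR.mem_eigenspace_iff.1 hu
      have h2 : ((t : ℂ) - a) ≠ 0 := by exact_mod_cast h0.ne'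
      push_cast
      exact (eq_inv_smul_iff₀ h2).2 h1
  exact h hv

/-- The projection fixes this subspace and takes values in a sum of finitely many eigenspaces, each
of finite multiplicity. -/
theorem finiteDimensional_spectralSubspace (hA : IsSelfAdjoint A)
    (hgap : Disjoint (Ioo (-1 : ℝ) 1) (essentialSpectrum A)) (ha : a ∈ Ioo (-1 : ℝ) 1)
    (hb : b ∈ Ioo (-1 : ℝ) 1) (ha' : a ∉ spectrum A) (hb' : b ∉ spectrum A) (hab : a < b) :
    FiniteDimensional ℂ (spectralSubspace A a b) := by
  have h : spectralSubspace A a b ≤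
      ⨆ t : ↥(_root_.spectrum ℝ (resolvent A a) ∩ Ioi (b - a)⁻¹), eigenspace A (a + (t : ℝ)⁻¹) := by
    intro v hv
    rw [← upperProjection_apply_of_mem_spectralSubspace hA ha' hb' hab hv]
    exact upperProjection_mem_iSup_eigenspace hA hgap ha hb ha' hb' hab v
  have hfin := (finite_spectrum_inter_Ioi (inv_sub_notMem_spectrum_resolvent ha' hb' hab)
    (eventually_eq_of_mem_spectrum_resolvent hgap ha hb ha' hab)).to_subtype
  have : ∀ t : ↥(_root_.spectrum ℝ (resolvent A a) ∩ Ioi (b - a)⁻¹),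
      FiniteDimensional ℂ (eigenspace A (a + (t : ℝ)⁻¹)) := fun t =>
    (add_inv_mem_discreteSpectrum hgap ha hb ha' hab t.2.1 t.2.2).2.2.2
  exact Submodule.finiteDimensional_of_le h

end SpectralGap

/-! ### Continuity of resolvents and frames in the gap topology. -/

section Family

variable {X : Type*}
  {H : Type*} [NormedAddCommGroup H] [InnerProductSpace ℂ H] [CompleteSpace H]
  {F : X → CFsa H} {l₀ a b : ℝ}

theorem isResolventAt_resolvent_neg_I (hspec : ∀ x, l₀ ∉ spectrum (F x).1) (x : X) :
    IsResolventAt (F x).1 (-Complex.I) (resolvent (F x).1 (-Complex.I)) :=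
  isResolventAt_resolvent
    (exists_isResolventAt_of_im_ne_zero (F x).2.1 (hspec x) (by simp))

variable [TopologicalSpace X]

theorem continuous_resolvent_neg_I (hF : Continuous F) :
    Continuous fun x => resolvent (F x).1 (-Complex.I) :=
  continuous_induced_dom.comp hF

theorem continuous_one_sub_smul_resolvent (hF : Continuous F) (z : ℂ) :
    Continuous fun x => (1 : H →L[ℂ] H) - z • resolvent (F x).1 (-Complex.I) :=
  continuous_const.sub (Continuous.const_smul (continuous_resolvent_neg_I hF) z)

/-- With R = (F x + i)⁻¹, the point a is in the resolvent set iff 1 - (a + i) R is a unit, and units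
form an open set. -/
theorem isOpen_standardOpen (hF : Continuous F) (hspec : ∀ x, l₀ ∉ spectrum (F x).1) (a : ℝ) :
    IsOpen (standardOpen F a) := by
  have h : standardOpen F a = (fun x => 1 - ((a : ℂ) - -Complex.I) •
      resolvent (F x).1 (-Complex.I)) ⁻¹' {T | IsUnit T} := by
    ext x
    exact (isResolventAt_resolvent_neg_I hspec x).notMem_spectrum_iff
  rw [h]
  exact Units.isOpen.preimage (continuous_one_sub_smul_resolvent hF _)

/-- Continuity follows from (F x - a)⁻¹ = R (1 - (a + i) R)⁻¹ with R = (F x + i)⁻¹. -/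
theorem continuousOn_resolvent (hF : Continuous F) (hspec : ∀ x, l₀ ∉ spectrum (F x).1) (a : ℝ) :
    ContinuousOn (fun x => resolvent (F x).1 a) (standardOpen F a) := by
  have hcont := continuous_resolvent_neg_I hF
  have hunit : ∀ x ∈ standardOpen F a,
      IsUnit (1 - ((a : ℂ) - -Complex.I) • resolvent (F x).1 (-Complex.I)) := fun x hx =>
    (isResolventAt_resolvent_neg_I hspec x).notMem_spectrum_iff.1 hx
  have h : ContinuousOn (fun x => resolvent (F x).1 (-Complex.I) * Ring.inverse
      (1 - ((a : ℂ) - -Complex.I) • resolvent (F x).1 (-Complex.I))) (standardOpen F a) := by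
    intro x hx
    obtain ⟨u, hu⟩ := hunit x hx
    have h1 : ContinuousAt Ring.inverse
        (1 - ((a : ℂ) - -Complex.I) • resolvent (F x).1 (-Complex.I)) := by
      rw [← hu]
      exact NormedRing.inverse_continuousAt u
    exact (hcont.continuousAt.mul (h1.comp
      (f := fun x => 1 - ((a : ℂ) - -Complex.I) • resolvent (F x).1 (-Complex.I))
      (continuous_one_sub_smul_resolvent hF _).continuousAt)).continuousWithinAt
  refine h.congr fun x hx => ?_
  exact ((isResolventAt_resolvent_neg_I hspec x).mul_inverse (hunit x hx)).resolvent_eq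

theorem exists_continuousOn_frame_spectralSubspace (hF : Continuous F)
    (hgap : ∀ x, Disjoint (Ioo (-1 : ℝ) 1) (essentialSpectrum (F x).1))
    (hspec : ∀ x, l₀ ∉ spectrum (F x).1) (ha : a ∈ Ioo (-1 : ℝ) 1) (hb : b ∈ Ioo (-1 : ℝ) 1)
    {x₀ : X} (ha' : x₀ ∈ standardOpen F a) (hb' : x₀ ∈ standardOpen F b) :
    ∃ N ∈ 𝓝 x₀, ∃ (n : ℕ) (e : X → Fin n → H), ContinuousOn e N ∧
      ∀ x ∈ N, IsOrthonormalFrame (spectralSubspace (F x).1 a b) (e x) := by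
  rcases lt_or_ge a b with hab | hab
  · refine exists_continuousOn_frame (t := standardOpen F a ∩ standardOpen F b)
      (P := fun x => upperProjection (resolvent (F x).1 a) (b - a)⁻¹)
      ((isOpen_standardOpen hF hspec a).inter (isOpen_standardOpen hF hspec b)) ?_
      (fun x hx => upperProjection_mem_spectralSubspace (F x).2.1 (hgap x) ha hb hx.1 hx.2 hab)
      (fun x hx v hv =>
        upperProjection_apply_of_mem_spectralSubspace (F x).2.1 hx.1 hx.2 hab hv)
      (fun x hx => finiteDimensional_spectralSubspace (F x).2.1 (hgap x) ha hb hx.1 hx.2 hab)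
      ⟨ha', hb'⟩
    exact continuousOn_upperProjection
      ((continuousOn_resolvent hF hspec a).mono inter_subset_left)
      (fun x hx => (isResolventAt_resolvent (not_not.1 hx.1)).isSelfAdjoint (F x).2.1)
      (fun x hx => inv_sub_notMem_spectrum_resolvent hx.1 hx.2 hab)
  · refine ⟨univ, univ_mem, 0, fun _ => Fin.elim0, continuousOn_const, fun x _ => ?_⟩
    rw [spectralSubspace_eq_bot hab]
    exact isOrthonormalFrame_bot _

end Family

section Regular

variable {X : Type*} {H : Type*} [NormedAddCommGroup H] [InnerProductSpace ℂ H] [CompleteSpace H]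
  {F : X → CFsa H} {a b : ℝ} {x₀ : X}

/-- `a` lies in `(-1, 1)` and outside the spectrum of `F x`. -/
def IsRegularAt (F : X → CFsa H) (x : X) (a : ℝ) : Prop :=
  a ∈ Ioo (-1 : ℝ) 1 ∧ x ∈ standardOpen F a

theorem IsRegularAt.eigenspace_eq_bot (h : IsRegularAt F x₀ a) : eigenspace (F x₀).1 a = ⊥ :=
  eigenspace_eq_bot_of_notMem_spectrum h.2

theorem IsRegularAt.min (ha : IsRegularAt F x₀ a) (hb : IsRegularAt F x₀ b) :
    IsRegularAt F x₀ (min a b) := by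
  rcases min_choice a b with h | h <;> rw [h] <;> assumption

end Regular

/-! ### Germs of unit sections of determinant lines and their transport. -/

section Sections

variable {X : Type*} [TopologicalSpace X]
  {H : Type*} [NormedAddCommGroup H] [InnerProductSpace ℂ H] [CompleteSpace H]
  {F : X → CFsa H} {l₀ a b m : ℝ} {x₀ : X} {w w' : X → ExteriorAlgebra ℂ H}

/-- `F` is continuous with common essential spectral gap `(-1, 1)`, and `l₀` lies in the common
resolvent set. -/
structure IsGapped (F : X → CFsa H) (l₀ : ℝ) : Prop where
  continuous : Continuous F
  gap : ∀ x, Disjoint (Ioo (-1 : ℝ) 1) (essentialSpectrum (F x).1)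
  notMem : ∀ x, l₀ ∉ spectrum (F x).1

/-- The germ at `x₀` of a unit section of the bundle of determinant lines `D(a, b)` that is
continuous at `x₀`. -/
def IsUnitVolumeAt (F : X → CFsa H) (a b : ℝ) (x₀ : X) (w : X → ExteriorAlgebra ℂ H) : Prop :=
  ∃ (n : ℕ) (e : X → Fin n → H) (c : X → Circle), ContinuousAt e x₀ ∧ ContinuousAt c x₀ ∧
    ∀ᶠ x in 𝓝 x₀, IsOrthonormalFrame (spectralSubspace (F x).1 a b) (e x) ∧
      w x = (c x : ℂ) • ExteriorAlgebra.ιMulti ℂ n (e x)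

theorem IsRegularAt.eventually (hF : IsGapped F l₀) (h : IsRegularAt F x₀ a) :
    ∀ᶠ x in 𝓝 x₀, IsRegularAt F x a := by
  filter_upwards [(isOpen_standardOpen hF.continuous hF.notMem a).mem_nhds h.2] with x hx
  exact ⟨h.1, hx⟩

theorem IsUnitVolumeAt.eventually (h : IsUnitVolumeAt F a b x₀ w) :
    ∀ᶠ x in 𝓝 x₀, IsUnitVolume (F x).1 a b (w x) := by
  obtain ⟨n, e, c, -, -, h⟩ := h
  filter_upwards [h] with x hx
  exact ⟨n, e x, c x, hx.1, hx.2⟩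

theorem IsUnitVolumeAt.isUnitVolume (h : IsUnitVolumeAt F a b x₀ w) :
    IsUnitVolume (F x₀).1 a b (w x₀) :=
  h.eventually.self_of_nhds

theorem exists_isUnitVolumeAt (hF : IsGapped F l₀) (ha : IsRegularAt F x₀ a)
    (hb : IsRegularAt F x₀ b) : ∃ w, IsUnitVolumeAt F a b x₀ w := by
  obtain ⟨N, hN, n, e, he, h⟩ := exists_continuousOn_frame_spectralSubspace
    hF.continuous hF.gap hF.notMem ha.1 hb.1 ha.2 hb.2
  refine ⟨fun x => ExteriorAlgebra.ιMulti ℂ n (e x), n, e, fun _ => 1, he.continuousAt hN,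
    continuousAt_const, ?_⟩
  filter_upwards [hN] with x hx
  exact ⟨h x hx, by simp⟩

theorem exists_isUnitVolume (hF : IsGapped F l₀) (ha : IsRegularAt F x₀ a)
    (hb : IsRegularAt F x₀ b) : ∃ w, IsUnitVolume (F x₀).1 a b w :=
  let ⟨w, hw⟩ := exists_isUnitVolumeAt hF ha hb
  ⟨w x₀, hw.isUnitVolume⟩

theorem exists_circle_eventually_eq {X : Type*} [TopologicalSpace X] {x₀ : X} {d : X → ℂ}
    (hd : ContinuousAt d x₀) (h : ∀ᶠ x in 𝓝 x₀, ‖d x‖ = 1) :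
    ∃ c : X → Circle, ContinuousAt c x₀ ∧ ∀ᶠ x in 𝓝 x₀, (c x : ℂ) = d x := by
  have h1 : ∀ x, ∃ c : Circle, ‖d x‖ = 1 → (c : ℂ) = d x := by
    intro x
    by_cases hx : ‖d x‖ = 1
    · exact ⟨⟨d x, mem_sphere_zero_iff_norm.2 hx⟩, fun _ => rfl⟩
    · exact ⟨1, fun h => (hx h).elim⟩
  choose c hc using h1
  have h2 : ∀ᶠ x in 𝓝 x₀, (c x : ℂ) = d x := h.mono hc
  refine ⟨c, ?_, h2⟩
  have h3 : IsInducing fun z : Circle => (z : ℂ) := IsInducing.subtypeVal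
  rw [h3.continuousAt_iff]
  exact hd.congr (h2.mono fun x hx => hx.symm)

/-- The exterior algebra carries no topology here; continuity of the ratio is read off from the
frames, whose change-of-basis determinant is continuous of modulus one. -/
theorem IsUnitVolumeAt.exists_eq_smul (h : IsUnitVolumeAt F a b x₀ w)
    (h' : IsUnitVolumeAt F a b x₀ w') :
    ∃ c : X → Circle, ContinuousAt c x₀ ∧ ∀ᶠ x in 𝓝 x₀, w x = (c x : ℂ) • w' x := by
  obtain ⟨n, e, c, he, hc, h⟩ := h
  obtain ⟨n', e', c', he', hc', h'⟩ := h'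
  obtain rfl : n = n' := by
    rw [← h.self_of_nhds.1.finrank_eq, ← h'.self_of_nhds.1.finrank_eq]
  have hdet : ContinuousAt (fun x => (Matrix.of fun i j => inner ℂ (e' x i) (e x j)).det) x₀ := by
    have : Continuous fun p : (Fin n → H) × (Fin n → H) =>
        (Matrix.of fun i j => inner ℂ (p.1 i) (p.2 j)).det := by
      refine Continuous.matrix_det ?_
      refine continuous_matrix fun i j => ?_
      exact ((continuous_apply i).comp continuous_fst).inner
        ((continuous_apply j).comp continuous_snd)
    exact ContinuousAt.comp (x := x₀) (f := fun x => (e' x, e x)) this.continuousAt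
      (he'.prodMk he)
  obtain ⟨d, hd, hd'⟩ := exists_circle_eventually_eq hdet (by
    filter_upwards [h, h'] with x hx hx'
    exact hx'.1.norm_det_eq_one hx.1)
  refine ⟨fun x => c x * d x * (c' x)⁻¹, (hc.mul hd).mul hc'.inv, ?_⟩
  filter_upwards [h, h', hd'] with x hx hx' hdx
  rw [hx.2, hx'.2, hx'.1.ιMulti_eq_det_smul hx.1.mem, ← hdx, smul_smul, smul_smul]
  congr 1
  have : (c' x : ℂ) ≠ 0 := (c' x).coe_ne_zero
  push_cast
  field_simp

theorem IsUnitVolumeAt.smul (h : IsUnitVolumeAt F a b x₀ w) {c : X → Circle}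
    (hc : ContinuousAt c x₀) : IsUnitVolumeAt F a b x₀ fun x => (c x : ℂ) • w x := by
  obtain ⟨n, e, c', he, hc', h⟩ := h
  refine ⟨n, e, fun x => c x * c' x, he, hc.mul hc', ?_⟩
  filter_upwards [h] with x hx
  exact ⟨hx.1, by rw [hx.2, smul_smul, Circle.coe_mul]⟩

theorem IsUnitVolumeAt.mul (hF : IsGapped F l₀) (hmb : m ≤ b) (hb : IsRegularAt F x₀ b)
    (h : IsUnitVolumeAt F m (min a b) x₀ w) (h' : IsUnitVolumeAt F b a x₀ w') :
    IsUnitVolumeAt F m a x₀ fun x => w x * w' x := by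
  obtain ⟨n, e, c, he, hc, h⟩ := h
  obtain ⟨n', e', c', he', hc', h'⟩ := h'
  refine ⟨n + n', fun x => Fin.append (e x) (e' x), fun x => c x * c' x, ?_, hc.mul hc', ?_⟩
  · refine continuousAt_pi.2 fun i => ?_
    induction i using Fin.addCases with
    | left i => simpa using continuousAt_pi.1 he i
    | right i => simpa using continuousAt_pi.1 he' i
  · filter_upwards [h, h', hb.eventually hF] with x hx hx' hbx
    refine ⟨hx.1.append_min (F x).2.1 hmb hbx.eigenspace_eq_bot hx'.1, ?_⟩
    rw [hx.2, hx'.2, smul_mul_smul_comm, ExteriorAlgebra.ιMulti_mul_ιMulti, Circle.coe_mul]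

variable {W : Set X} {s : ∀ x, line (F x).1 a b}

theorem IsUnitSection.exists_isUnitVolumeAt (hs : IsUnitSection F a b W s) (hx₀ : x₀ ∈ W) :
    ∃ q r, IsUnitVolumeAt F b a x₀ q ∧ IsUnitVolumeAt F a b x₀ r ∧
      ∀ᶠ x in 𝓝 x₀, ∀ y : detLine (F x).1 b a, (y : ExteriorAlgebra ℂ H) = q x →
        (s x y : ExteriorAlgebra ℂ H) = r x := by
  obtain ⟨N, hN, n, k, e, e', c, he, he', hc, h⟩ := hs x₀ hx₀
  refine ⟨fun x => ExteriorAlgebra.ιMulti ℂ k (e' x),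
    fun x => (c x : ℂ) • ExteriorAlgebra.ιMulti ℂ n (e x),
    ⟨k, e', fun _ => 1, he'.continuousAt hN, continuousAt_const, ?_⟩,
    ⟨n, e, c, he.continuousAt hN, hc.continuousAt hN, ?_⟩, ?_⟩
  · filter_upwards [hN] with x hx
    exact ⟨(h x hx).2.1, by simp⟩
  · filter_upwards [hN] with x hx
    exact ⟨(h x hx).1, rfl⟩
  · filter_upwards [hN] with x hx
    exact (h x hx).2.2

/-- Locally w is a phase times p ∧ q, with q the frame vector of D(b, a) that s sends to r; its
image is the same phase times p ∧ r. -/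
theorem IsUnitSection.exists_acts (hF : IsGapped F l₀) (hs : IsUnitSection F a b W s)
    (hx₀ : x₀ ∈ W) (hma : m ≤ a) (hmb : m ≤ b) (hm : IsRegularAt F x₀ m)
    (ha : IsRegularAt F x₀ a) (hb : IsRegularAt F x₀ b) (hw : IsUnitVolumeAt F m a x₀ w) :
    ∃ w', IsUnitVolumeAt F m b x₀ w' ∧ ∀ᶠ x in 𝓝 x₀, Acts (F x).1 m (s x) (w x) (w' x) := by
  obtain ⟨q, r, hq, hr, hqr⟩ := hs.exists_isUnitVolumeAt hx₀
  obtain ⟨p, hp⟩ := FermiGerbe.exists_isUnitVolumeAt hF hm (ha.min hb)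
  obtain ⟨c, hc, hcw⟩ := hw.exists_eq_smul (IsUnitVolumeAt.mul hF hmb hb hp hq)
  -- The same p completes q to D(m, a) and r to D(m, b), since min a b is symmetric.
  have hp' := hp
  rw [min_comm] at hp'
  refine ⟨_, (IsUnitVolumeAt.mul hF hma ha hp' hr).smul hc, ?_⟩
  filter_upwards [hcw, hqr, hp.eventually, hq.eventually] with x hx hx' hpx hqx
  refine ⟨(c x : ℂ) • p x, Submodule.smul_mem _ _ hpx.mem, ⟨q x, hqx.mem⟩, ?_, ?_⟩
  · rw [hx, smul_mul_assoc]
  · rw [hx' _ rfl, smul_mul_assoc]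

theorem Acts.eq (hF : IsGapped F l₀) (hmb : m ≤ b)
    (hm : IsRegularAt F x₀ m) (ha : IsRegularAt F x₀ a) (hb : IsRegularAt F x₀ b)
    {f : line (F x₀).1 a b} {w w' w'' : ExteriorAlgebra ℂ H} (h : Acts (F x₀).1 m f w w')
    (h' : Acts (F x₀).1 m f w w'') : w' = w'' := by
  obtain ⟨p, hp⟩ := exists_isUnitVolume hF hm (ha.min hb)
  obtain ⟨q, hq⟩ := exists_isUnitVolume hF hb ha
  exact h.unique h' hp hq (hp.mul (F x₀).2.1 hmb hb.eigenspace_eq_bot hq).ne_zero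

theorem exists_linearMap_apply_eq {V V' : Type*} [AddCommGroup V] [Module ℂ V] [AddCommGroup V']
    [Module ℂ V'] {v : V} (hv : v ≠ 0) (v' : V') : ∃ f : V →ₗ[ℂ] V', f v = v' := by
  have h : ∃ φ : Module.Dual ℂ V, φ v ≠ 0 := by
    by_contra! h
    exact hv ((Module.forall_dual_apply_eq_zero_iff ℂ v).1 h)
  obtain ⟨φ, hφ⟩ := h
  refine ⟨(φ v)⁻¹ • φ.smulRight v', ?_⟩
  simp [smul_smul, hφ]

/-- Send the local frame vector of D(b, a) to that of D(a, b). -/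
theorem exists_isUnitSection (hF : IsGapped F l₀) (ha : IsRegularAt F x₀ a)
    (hb : IsRegularAt F x₀ b) : ∃ (W : Opens X) (t : ∀ x, line (F x).1 a b),
      x₀ ∈ W ∧ IsUnitSection F a b W t := by
  obtain ⟨N, hN, n, e, he, h⟩ := exists_continuousOn_frame_spectralSubspace
    hF.continuous hF.gap hF.notMem ha.1 hb.1 ha.2 hb.2
  obtain ⟨N', hN', n', e', he', h'⟩ := exists_continuousOn_frame_spectralSubspace
    hF.continuous hF.gap hF.notMem hb.1 ha.1 hb.2 ha.2
  have h1 : ∀ x, ∃ f : line (F x).1 a b, x ∈ N ∩ N' → ∀ q : detLine (F x).1 b a,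
      (q : ExteriorAlgebra ℂ H) = ExteriorAlgebra.ιMulti ℂ n' (e' x) →
        (f q : ExteriorAlgebra ℂ H) = ExteriorAlgebra.ιMulti ℂ n (e x) := by
    intro x
    by_cases hx : x ∈ N ∩ N'
    · have hv : IsUnitVolume (F x).1 b a (ExteriorAlgebra.ιMulti ℂ n' (e' x)) :=
        ⟨n', e' x, 1, h' x hx.2, by simp⟩
      have hw : IsUnitVolume (F x).1 a b (ExteriorAlgebra.ιMulti ℂ n (e x)) :=
        ⟨n, e x, 1, h x hx.1, by simp⟩
      obtain ⟨f, hf⟩ := exists_linearMap_apply_eq (v := (⟨_, hv.mem⟩ : detLine (F x).1 b a))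
        (fun h0 => hv.ne_zero (congrArg Subtype.val h0)) (⟨_, hw.mem⟩ : detLine (F x).1 a b)
      refine ⟨f, fun _ q hq => ?_⟩
      have : q = ⟨_, hv.mem⟩ := Subtype.ext hq
      rw [this, hf]
    · exact ⟨0, fun h => (hx h).elim⟩
  choose t ht using h1
  refine ⟨⟨interior (N ∩ N'), isOpen_interior⟩, t, mem_interior_iff_mem_nhds.2 (inter_mem hN hN'),
    fun x hx => ⟨N ∩ N', mem_interior_iff_mem_nhds.1 hx, n, n', e, e', fun _ => 1,
      he.mono inter_subset_left, he'.mono inter_subset_right, continuousOn_const,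
      fun y hy => ⟨h y hy.1, h' y hy.2, fun q hq => ?_⟩⟩⟩
  rw [ht y hy q hq]
  simp

end Sections

/-! ### Transition phases and the cocycle identity. -/

section Transition

/-- For vectors `t`, `t'` in `L(l, a)`, `L(l, b)` and `s` in `L(a, b)`, the composition
`D(m, l) → D(m, a) → D(m, b)` of the actions of `t` and `s` is `z` times the action of `t'`. -/
def IsTransition {H : Type*} [NormedAddCommGroup H] [InnerProductSpace ℂ H]
    (A : H →ₗ.[ℂ] H) (m : ℝ) {l a b : ℝ} (t : line A l a) (t' : line A l b) (s : line A a b)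
    (z : ℂ) : Prop :=
  ∃ θ w w', IsUnitVolume A m l θ ∧ IsUnitVolume A m b w' ∧ Acts A m t θ w ∧ Acts A m t' θ w' ∧
    Acts A m s w (z • w')

variable {X : Type*} [TopologicalSpace X]
  {H : Type*} [NormedAddCommGroup H] [InnerProductSpace ℂ H] [CompleteSpace H]
  {F : X → CFsa H} {l₀ l a b c m m' : ℝ} {x₀ : X}

theorem exists_isTransition (hF : IsGapped F l₀) {W W' W'' : Set X} {t : ∀ x, line (F x).1 l a}
    {t' : ∀ x, line (F x).1 l b} {s : ∀ x, line (F x).1 a b} (ht : IsUnitSection F l a W t)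
    (ht' : IsUnitSection F l b W' t') (hs : IsUnitSection F a b W'' s) (hx : x₀ ∈ W)
    (hx' : x₀ ∈ W') (hx'' : x₀ ∈ W'') (hml : m ≤ l) (hma : m ≤ a) (hmb : m ≤ b)
    (hm : IsRegularAt F x₀ m) (hl : IsRegularAt F x₀ l) (ha : IsRegularAt F x₀ a)
    (hb : IsRegularAt F x₀ b) :
    ∃ z : X → Circle, ContinuousAt z x₀ ∧
      ∀ᶠ x in 𝓝 x₀, IsTransition (F x).1 m (t x) (t' x) (s x) (z x) := by
  obtain ⟨θ, hθ⟩ := exists_isUnitVolumeAt hF hm hl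
  obtain ⟨w, hw, hθw⟩ := ht.exists_acts hF hx hml hma hm hl ha hθ
  obtain ⟨w', hw', hθw'⟩ := ht'.exists_acts hF hx' hml hmb hm hl hb hθ
  obtain ⟨v, hv, hwv⟩ := hs.exists_acts hF hx'' hma hmb hm ha hb hw
  obtain ⟨z, hz, hzv⟩ := hv.exists_eq_smul hw'
  refine ⟨z, hz, ?_⟩
  filter_upwards [hθ.eventually, hw'.eventually, hθw, hθw', hwv, hzv] with x h1 h2 h3 h4 h5 h6
  exact ⟨θ x, w x, w' x, h1, h2, h3, h4, h6 ▸ h5⟩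

variable {t : line (F x₀).1 l a} {t' : line (F x₀).1 l b} {s : line (F x₀).1 a b} {z z' : ℂ}

/-- The relation holds for every θ once it holds for one, because D(m, l) is a line and the actions
are homogeneous. -/
theorem IsTransition.acts (hF : IsGapped F l₀) (hma : m ≤ a) (hmb : m ≤ b)
    (hm : IsRegularAt F x₀ m) (hl : IsRegularAt F x₀ l) (ha : IsRegularAt F x₀ a)
    (hb : IsRegularAt F x₀ b) (h : IsTransition (F x₀).1 m t t' s z)
    {θ w w' : ExteriorAlgebra ℂ H} (hθ : IsUnitVolume (F x₀).1 m l θ)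
    (h1 : Acts (F x₀).1 m t θ w) (h2 : Acts (F x₀).1 m t' θ w') :
    Acts (F x₀).1 m s w (z • w') := by
  obtain ⟨θ₁, w₁, w₁', hθ₁, hw₁, h3, h4, h5⟩ := h
  obtain ⟨u, rfl⟩ := hθ₁.exists_eq_smul hθ.mem
  obtain rfl := h1.eq hF hma hm hl ha (h3.smul_smul u)
  obtain rfl := h2.eq hF hmb hm hl hb (h4.smul_smul u)
  rw [smul_comm z u]
  exact h5.smul_smul u

theorem IsTransition.unique (hF : IsGapped F l₀) (hma : m ≤ a) (hmb : m ≤ b)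
    (hm : IsRegularAt F x₀ m) (hl : IsRegularAt F x₀ l) (ha : IsRegularAt F x₀ a)
    (hb : IsRegularAt F x₀ b) (h : IsTransition (F x₀).1 m t t' s z)
    (h' : IsTransition (F x₀).1 m t t' s z') : z = z' := by
  obtain ⟨θ, w, w', hθ, hw, h1, h2, h3⟩ := h
  have h4 := h'.acts hF hma hmb hm hl ha hb hθ h1 h2
  exact smul_left_injective ℂ hw.ne_zero (h3.eq hF hmb hm ha hb h4)

/-- Multiply all the witnesses on the left by a unit vector of D(m', m). This lets phases computed
with different base points be compared. -/
theorem IsTransition.of_le (hF : IsGapped F l₀) (hmm' : m' ≤ m) (hml : m ≤ l) (hma : m ≤ a)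
    (hmb : m ≤ b) (hm' : IsRegularAt F x₀ m') (hm : IsRegularAt F x₀ m) (hl : IsRegularAt F x₀ l)
    (ha : IsRegularAt F x₀ a) (hb : IsRegularAt F x₀ b)
    (h : IsTransition (F x₀).1 m t t' s z) : IsTransition (F x₀).1 m' t t' s z := by
  obtain ⟨θ, w, w', hθ, hw, h1, h2, h3⟩ := h
  obtain ⟨p, hp⟩ := exists_isUnitVolume hF hm' hm
  have hA := (F x₀).2.1
  have key : ∀ {k : ℝ} {v : ExteriorAlgebra ℂ H}, m ≤ k → IsUnitVolume (F x₀).1 m k v →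
      IsUnitVolume (F x₀).1 m' k (p * v) := fun {k v} hk hv =>
    IsUnitVolume.mul hA hmm' hm.eigenspace_eq_bot (by rwa [min_eq_right hk]) hv
  obtain ⟨q₁, hq₁⟩ := exists_isUnitVolume hF hm (hl.min ha)
  obtain ⟨q₂, hq₂⟩ := exists_isUnitVolume hF hm (hl.min hb)
  obtain ⟨q₃, hq₃⟩ := exists_isUnitVolume hF hm (ha.min hb)
  refine ⟨p * θ, p * w, p * w', key hml hθ, key hmb hw,
    h1.mul_left hA hmm' hml hma hm.eigenspace_eq_bot hp hq₁,
    h2.mul_left hA hmm' hml hmb hm.eigenspace_eq_bot hp hq₂, ?_⟩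
  rw [← mul_smul_comm]
  exact h3.mul_left hA hmm' hma hmb hm.eigenspace_eq_bot hp hq₃

/-- `IsProduct` speaks only of the base point min a b c, whereas l₀ may lie below it; the relation
is carried down to m. -/
theorem IsProduct.acts (hF : IsGapped F l₀) {W W' : Set X} {f : ∀ x, line (F x).1 a b}
    {g : ∀ x, line (F x).1 b c} {h : line (F x₀).1 a c} (hf : IsUnitSection F a b W f)
    (hg : IsUnitSection F b c W' g) (hx : x₀ ∈ W) (hx' : x₀ ∈ W')
    (hp : IsProduct (F x₀).1 (f x₀) (g x₀) h) (hma : m ≤ a) (hmb : m ≤ b) (hmc : m ≤ c)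
    (hm : IsRegularAt F x₀ m) (ha : IsRegularAt F x₀ a) (hb : IsRegularAt F x₀ b)
    (hc : IsRegularAt F x₀ c) {w w' w'' : ExteriorAlgebra ℂ H} (hw : IsUnitVolume (F x₀).1 m a w)
    (h1 : Acts (F x₀).1 m (f x₀) w w') (h2 : Acts (F x₀).1 m (g x₀) w' w'') :
    Acts (F x₀).1 m h w w'' := by
  have hA := (F x₀).2.1
  set M := min a (min b c)
  have hM : IsRegularAt F x₀ M := ha.min (hb.min hc)
  have hMa : M ≤ a := min_le_left _ _
  have hMb : M ≤ b := (min_le_right _ _).trans (min_le_left _ _)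
  have hMc : M ≤ c := (min_le_right _ _).trans (min_le_right _ _)
  have hmM : m ≤ M := le_min hma (le_min hmb hmc)
  -- Explicit vectors on which f and g act are needed, as `IsProduct` is conditional on such
  -- actions.
  obtain ⟨v, hv⟩ := exists_isUnitVolumeAt hF hM ha
  obtain ⟨v', hv', hvv'⟩ := hf.exists_acts hF hx hMa hMb hM ha hb hv
  obtain ⟨v'', -, hv'v''⟩ := hg.exists_acts hF hx' hMb hMc hM hb hc hv'
  have h3 := hp _ hv.isUnitVolume.mem _ _ hvv'.self_of_nhds hv'v''.self_of_nhds
  obtain ⟨p, hp⟩ := exists_isUnitVolume hF hm hM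
  obtain ⟨q₁, hq₁⟩ := exists_isUnitVolume hF hM (ha.min hb)
  obtain ⟨q₂, hq₂⟩ := exists_isUnitVolume hF hM (hb.min hc)
  obtain ⟨q₃, hq₃⟩ := exists_isUnitVolume hF hM (ha.min hc)
  have hpv : IsUnitVolume (F x₀).1 m a (p * v x₀) :=
    IsUnitVolume.mul hA hmM hM.eigenspace_eq_bot (by rwa [min_eq_right hMa]) hv.isUnitVolume
  obtain ⟨u, rfl⟩ := hpv.exists_eq_smul hw.mem
  have h4 := (hvv'.self_of_nhds.mul_left hA hmM hMa hMb hM.eigenspace_eq_bot hp hq₁).smul_smul u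
  obtain rfl := h1.eq hF hmb hm ha hb h4
  have h5 := (hv'v''.self_of_nhds.mul_left hA hmM hMb hMc hM.eigenspace_eq_bot hp hq₂).smul_smul u
  obtain rfl := h2.eq hF hmc hm hb hc h5
  exact (h3.mul_left hA hmM hMa hMc hM.eigenspace_eq_bot hp hq₃).smul_smul u

/-- Let w₁, w₂, w₃ be the images of θ under t₁, t₂, t₃. Then s₂₃ ∘ s₁₂ sends w₁ to z₁₂ z₂₃ w₃, while
g • s₁₃ sends it to g z₁₃ w₃. -/
theorem IsTransition.mul_eq (hF : IsGapped F l₀) {W₁ W₂ W₃ W₁₂ W₂₃ : Set X}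
    {t₁ : ∀ x, line (F x).1 l a} {t₂ : ∀ x, line (F x).1 l b} {t₃ : ∀ x, line (F x).1 l c}
    {s₁₂ : ∀ x, line (F x).1 a b} {s₂₃ : ∀ x, line (F x).1 b c} {s₁₃ : line (F x₀).1 a c}
    {g z₁₂ z₂₃ z₁₃ : ℂ} (ht₁ : IsUnitSection F l a W₁ t₁) (ht₂ : IsUnitSection F l b W₂ t₂)
    (ht₃ : IsUnitSection F l c W₃ t₃) (hs₁₂ : IsUnitSection F a b W₁₂ s₁₂)
    (hs₂₃ : IsUnitSection F b c W₂₃ s₂₃) (hx₁ : x₀ ∈ W₁) (hx₂ : x₀ ∈ W₂) (hx₃ : x₀ ∈ W₃)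
    (hx₁₂ : x₀ ∈ W₁₂) (hx₂₃ : x₀ ∈ W₂₃)
    (hp : IsProduct (F x₀).1 (s₁₂ x₀) (s₂₃ x₀) (g • s₁₃))
    (hml : m ≤ l) (hma : m ≤ a) (hmb : m ≤ b) (hmc : m ≤ c) (hm : IsRegularAt F x₀ m)
    (hl : IsRegularAt F x₀ l) (ha : IsRegularAt F x₀ a) (hb : IsRegularAt F x₀ b)
    (hc : IsRegularAt F x₀ c) (h₁₂ : IsTransition (F x₀).1 m (t₁ x₀) (t₂ x₀) (s₁₂ x₀) z₁₂)
    (h₂₃ : IsTransition (F x₀).1 m (t₂ x₀) (t₃ x₀) (s₂₃ x₀) z₂₃)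
    (h₁₃ : IsTransition (F x₀).1 m (t₁ x₀) (t₃ x₀) s₁₃ z₁₃) : z₁₂ * z₂₃ = g * z₁₃ := by
  obtain ⟨θ, hθ⟩ := exists_isUnitVolumeAt hF hm hl
  obtain ⟨w₁, hw₁, h1⟩ := ht₁.exists_acts hF hx₁ hml hma hm hl ha hθ
  obtain ⟨w₂, -, h2⟩ := ht₂.exists_acts hF hx₂ hml hmb hm hl hb hθ
  obtain ⟨w₃, hw₃, h3⟩ := ht₃.exists_acts hF hx₃ hml hmc hm hl hc hθ
  have k₁₂ := h₁₂.acts hF hma hmb hm hl ha hb hθ.isUnitVolume h1.self_of_nhds h2.self_of_nhds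
  have k₂₃ := h₂₃.acts hF hmb hmc hm hl hb hc hθ.isUnitVolume h2.self_of_nhds h3.self_of_nhds
  have k₁₃ := h₁₃.acts hF hma hmc hm hl ha hc hθ.isUnitVolume h1.self_of_nhds h3.self_of_nhds
  have k := hp.acts hF hs₁₂ hs₂₃ hx₁₂ hx₂₃ hma hmb hmc hm ha hb hc hw₁.isUnitVolume k₁₂
    (k₂₃.smul_smul z₁₂)
  have k' := k.eq hF hmc hm ha hc (k₁₃.const_smul g)
  rw [smul_smul, smul_smul] at k'
  exact smul_left_injective ℂ hw₃.isUnitVolume.ne_zero k'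

end Transition

/-! ### Vanishing of classes in the direct limit. -/

section Cech

variable {X : Type*} [TopologicalSpace X] {A : Type*} [AddCommGroup A] [TopologicalSpace A]
  [IsTopologicalAddGroup A]

theorem cechClass_eq_zero_of_res_mem {V W : PointedCover X} (h : V ≤ W) {n : ℕ}
    {c : cocycles A V n} (hc : res h n c.1 ∈ coboundaries A W n) : cechClass c = 0 := by
  classical
  have h1 := AddCommGroup.DirectLimit.of_f
    (G := fun V : PointedCover X => CoverCohomology A V n) (f := refine A n) (hij := h)
    (x := (QuotientAddGroup.mk c : CoverCohomology A V n))
  have h2 : refine A n V W h (QuotientAddGroup.mk c) = 0 :=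
    (QuotientAddGroup.eq_zero_iff _).2 (AddSubgroup.mem_addSubgroupOf.2 hc)
  rw [h2, map_zero] at h1
  exact h1.symm

theorem cechClass_zero (V : PointedCover X) (n : ℕ) : cechClass (0 : cocycles A V n) = 0 :=
  cechClass_eq_zero_of_res_mem le_rfl (by
    rw [ZeroMemClass.coe_zero, map_zero]
    exact zero_mem _)

instance : IsDirectedOrder (PointedCover X) where
  directed V W := ⟨⟨fun x => V.nhd x ⊓ W.nhd x, fun x => ⟨V.mem x, W.mem x⟩⟩,
    fun _ => inf_le_left, fun _ => inf_le_right⟩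

instance (n : ℕ) : DirectedSystem (fun V : PointedCover X => CoverCohomology A V n)
    fun V W h => refine A n V W h where
  map_self V x := by
    obtain ⟨c, rfl⟩ := QuotientAddGroup.mk_surjective x
    rfl
  map_map U V W h h' x := by
    obtain ⟨c, rfl⟩ := QuotientAddGroup.mk_surjective x
    rfl

/-- In a directed limit, an element that vanishes already vanishes at some later stage; the two
instances above supply directedness. -/
theorem exists_res_mem_of_cechClass_eq_zero {V : PointedCover X} {n : ℕ} {c : cocycles A V n}
    (hc : cechClass c = 0) :
    ∃ (W : PointedCover X) (h : V ≤ W), res h n c.1 ∈ coboundaries A W n := by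
  classical
  have : Nonempty (PointedCover X) := ⟨V⟩
  obtain ⟨W, h, h'⟩ := AddCommGroup.DirectLimit.of.zero_exact
    (G := fun V : PointedCover X => CoverCohomology A V n) (f := refine A n) V
    (QuotientAddGroup.mk c) hc
  exact ⟨W, h, AddSubgroup.mem_addSubgroupOf.1 ((QuotientAddGroup.eq_zero_iff _).1 h')⟩

end Cech

section Eval

variable {X : Type*} [TopologicalSpace X] {A : Type*} [AddCommGroup A] [TopologicalSpace A]

open Classical in
/-- The value of a cochain at a point, with junk value `0` outside of the intersection. -/
noncomputable def Cochain.eval {V : PointedCover X} {n : ℕ} (c : Cochain A V n)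
    (i : Fin (n + 1) → X) (p : X) : A :=
  if h : p ∈ V.inter i then c i ⟨p, h⟩ else 0

theorem Cochain.eval_of_mem {V : PointedCover X} {n : ℕ} (c : Cochain A V n)
    {i : Fin (n + 1) → X} {p : X} (h : p ∈ V.inter i) : Cochain.eval c i p = c i ⟨p, h⟩ :=
  dif_pos h

theorem PointedCover.mem_inter_two {V : PointedCover X} {a b p : X} (ha : p ∈ V.nhd a)
    (hb : p ∈ V.nhd b) : p ∈ V.inter ![a, b] := by
  intro k
  fin_cases k
  exacts [ha, hb]

theorem PointedCover.mem_inter_three {V : PointedCover X} {a b c p : X} (ha : p ∈ V.nhd a)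
    (hb : p ∈ V.nhd b) (hc : p ∈ V.nhd c) : p ∈ V.inter ![a, b, c] := by
  intro k
  fin_cases k
  exacts [ha, hb, hc]

theorem PointedCover.mem_inter_four {V : PointedCover X} {a b c d p : X} (ha : p ∈ V.nhd a)
    (hb : p ∈ V.nhd b) (hc : p ∈ V.nhd c) (hd : p ∈ V.nhd d) : p ∈ V.inter ![a, b, c, d] := by
  intro k
  fin_cases k
  exacts [ha, hb, hc, hd]

variable [IsTopologicalAddGroup A]

theorem eval_cechD {V : PointedCover X} {n : ℕ} (c : Cochain A V n) {i : Fin (n + 2) → X} {p : X}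
    (h : p ∈ V.inter i) : Cochain.eval (cechD A V n c) i p =
      ∑ k : Fin (n + 2), (-1 : ℤ) ^ (k : ℕ) • Cochain.eval c (i ∘ k.succAbove) p := by
  rw [Cochain.eval_of_mem _ h, cechD_apply]
  refine Finset.sum_congr rfl fun k _ => ?_
  rw [Cochain.eval_of_mem (i := i ∘ k.succAbove) c fun l => h (k.succAbove l)]

theorem eval_cechD_one {V : PointedCover X} (g : Cochain A V 1) {a b c p : X} (ha : p ∈ V.nhd a)
    (hb : p ∈ V.nhd b) (hc : p ∈ V.nhd c) : Cochain.eval (cechD A V 1 g) ![a, b, c] p =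
      Cochain.eval g ![b, c] p - Cochain.eval g ![a, c] p + Cochain.eval g ![a, b] p := by
  rw [eval_cechD _ (PointedCover.mem_inter_three ha hb hc), Fin.sum_univ_three,
    show ![a, b, c] ∘ Fin.succAbove 0 = ![b, c] by ext k; fin_cases k <;> rfl,
    show ![a, b, c] ∘ Fin.succAbove 1 = ![a, c] by ext k; fin_cases k <;> rfl,
    show ![a, b, c] ∘ Fin.succAbove 2 = ![a, b] by ext k; fin_cases k <;> rfl]
  simp [sub_eq_add_neg]

theorem eval_cechD_two {V : PointedCover X} (g : Cochain A V 2) {a b c d p : X}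
    (ha : p ∈ V.nhd a) (hb : p ∈ V.nhd b) (hc : p ∈ V.nhd c) (hd : p ∈ V.nhd d) :
    Cochain.eval (cechD A V 2 g) ![a, b, c, d] p =
      Cochain.eval g ![b, c, d] p - Cochain.eval g ![a, c, d] p + Cochain.eval g ![a, b, d] p -
        Cochain.eval g ![a, b, c] p := by
  rw [eval_cechD _ (PointedCover.mem_inter_four ha hb hc hd), Fin.sum_univ_four,
    show ![a, b, c, d] ∘ Fin.succAbove 0 = ![b, c, d] by ext k; fin_cases k <;> rfl,
    show ![a, b, c, d] ∘ Fin.succAbove 1 = ![a, c, d] by ext k; fin_cases k <;> rfl,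
    show ![a, b, c, d] ∘ Fin.succAbove 2 = ![a, b, d] by ext k; fin_cases k <;> rfl,
    show ![a, b, c, d] ∘ Fin.succAbove 3 = ![a, b, c] by ext k; fin_cases k <;> rfl]
  simp [sub_eq_add_neg]

theorem cechD_cechD_one {V : PointedCover X} (g : Cochain A V 1) :
    cechD A V 2 (cechD A V 1 g) = 0 := by
  funext i
  refine ContinuousMap.ext fun x => ?_
  obtain ⟨a, b, c, d, rfl⟩ : ∃ a b c d, i = ![a, b, c, d] :=
    ⟨i 0, i 1, i 2, i 3, by ext k; fin_cases k <;> rfl⟩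
  have ha : x.1 ∈ V.nhd a := x.2 0
  have hb : x.1 ∈ V.nhd b := x.2 1
  have hc : x.1 ∈ V.nhd c := x.2 2
  have hd : x.1 ∈ V.nhd d := x.2 3
  have h := eval_cechD_two (cechD A V 1 g) ha hb hc hd
  rw [Cochain.eval_of_mem _ x.2, eval_cechD_one g hb hc hd, eval_cechD_one g ha hc hd,
    eval_cechD_one g ha hb hd, eval_cechD_one g ha hb hc] at h
  rw [h]
  change _ = (0 : A)
  abel

end Eval

/-! ### The class in degree two. -/

section GerbeClass

variable {X : Type*} [TopologicalSpace X]
  {H : Type*} [NormedAddCommGroup H] [InnerProductSpace ℂ H] [CompleteSpace H]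
  {F : X → CFsa H} {l₀ : ℝ}

/-- With ℓ = l₀ everywhere all determinant lines are ℂ · 1, and the identity sections have cocycle
1. -/
theorem isGerbeClass_zero (hl₀ : l₀ ∈ Ioo (-1 : ℝ) 1) (hspec : ∀ x, l₀ ∉ spectrum (F x).1) :
    IsGerbeClass F 0 := by
  refine ⟨⟨fun _ => ⊤, fun _ => trivial⟩, fun _ => l₀, fun _ _ _ => LinearMap.id, 0,
    fun i => ⟨hl₀, fun x _ => hspec x⟩, fun i j x₀ _ => ?_, fun i j k x => ?_, cechClass_zero _ _⟩
  · refine ⟨univ, univ_mem, 0, 0, fun _ => Fin.elim0, fun _ => Fin.elim0, fun _ => 1,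
      continuousOn_const, continuousOn_const, continuousOn_const, fun x _ => ?_⟩
    have h : IsOrthonormalFrame (spectralSubspace (F x).1 l₀ l₀) (Fin.elim0 : Fin 0 → H) := by
      rw [spectralSubspace_eq_bot le_rfl]
      exact isOrthonormalFrame_bot _
    refine ⟨h, h, fun q hq => ?_⟩
    simp [hq]
  · rintro w - w' w'' ⟨p, hp, q, rfl, rfl⟩ ⟨p', hp', q', h, rfl⟩
    refine ⟨p, hp, q, rfl, ?_⟩
    have h1 : ((0 : cocycles (Additive Circle) _ 2).1 ![i, j, k] x).toMul = 1 := rfl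
    rw [h1, Circle.coe_one, one_smul]
    exact h.symm

/-- The 1-cochain of phases b_ij with t_i · s_ij = b_ij t_j has coboundary g. -/
theorem eq_zero_of_isGerbeClass (hF : IsGapped F l₀) (hl₀ : l₀ ∈ Ioo (-1 : ℝ) 1)
    {u : CechCohomology X (Additive Circle) 2} (hu : IsGerbeClass F u) : u = 0 := by
  obtain ⟨V, ℓ, s, g, hℓ, hs, hg, rfl⟩ := hu
  have hreg₀ : ∀ x, IsRegularAt F x l₀ := fun x => ⟨hl₀, hF.notMem x⟩
  have hreg : ∀ i, ∀ x ∈ V.nhd i, IsRegularAt F x (ℓ i) := fun i x hx =>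
    ⟨(hℓ i).1, (hℓ i).2 hx⟩
  have h1 := fun i => exists_isUnitSection hF (hreg₀ i) (hreg i i (V.mem i))
  choose N t hN ht using h1
  -- A section t_i is needed only near the point i, since covers are indexed by points.
  let W : PointedCover X := ⟨fun i => V.nhd i ⊓ N i, fun i => ⟨V.mem i, hN i⟩⟩
  have hVW : V ≤ W := fun i => inf_le_left
  let m : X → X → ℝ := fun i j => min l₀ (min (ℓ i) (ℓ j))
  have hm₀ : ∀ i j, m i j ≤ l₀ := fun i j => min_le_left _ _
  have hm₁ : ∀ i j, m i j ≤ ℓ i := fun i j => (min_le_right _ _).trans (min_le_left _ _)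
  have hm₂ : ∀ i j, m i j ≤ ℓ j := fun i j => (min_le_right _ _).trans (min_le_right _ _)
  have hmreg : ∀ i j x, x ∈ W.nhd i → x ∈ W.nhd j → IsRegularAt F x (m i j) :=
    fun i j x hi hj => (hreg₀ x).min ((hreg i x hi.1).min (hreg j x hj.1))
  have h2 : ∀ i j x₀, x₀ ∈ W.nhd i → x₀ ∈ W.nhd j → ∃ z : X → Circle, ContinuousAt z x₀ ∧
      ∀ᶠ x in 𝓝 x₀, IsTransition (F x).1 (m i j) (t i x) (t j x) (s i j x) (z x) :=
    fun i j x₀ hi hj => exists_isTransition hF (ht i) (ht j) (hs i j) hi.2 hj.2 ⟨hi.1, hj.1⟩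
      (hm₀ i j) (hm₁ i j) (hm₂ i j) (hmreg i j x₀ hi hj) (hreg₀ x₀) (hreg i x₀ hi.1)
      (hreg j x₀ hj.1)
  have h3 : ∀ i j x, ∃ z : Circle, x ∈ W.nhd i → x ∈ W.nhd j →
      IsTransition (F x).1 (m i j) (t i x) (t j x) (s i j x) z := by
    intro i j x
    by_cases hx : x ∈ W.nhd i ∧ x ∈ W.nhd j
    · obtain ⟨z, -, hz⟩ := h2 i j x hx.1 hx.2
      exact ⟨z x, fun _ _ => hz.self_of_nhds⟩
    · exact ⟨1, fun hi hj => (hx ⟨hi, hj⟩).elim⟩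
  choose B hB using h3
  have hBcont : ∀ i j x₀, x₀ ∈ W.nhd i → x₀ ∈ W.nhd j → ContinuousAt (B i j) x₀ := by
    -- B was chosen pointwise; uniqueness of the phase identifies it with the continuous local
    -- solution.
    intro i j x₀ hi hj
    obtain ⟨z, hz, hz'⟩ := h2 i j x₀ hi hj
    refine hz.congr ?_
    filter_upwards [hz', (W.nhd i).isOpen.mem_nhds hi, (W.nhd j).isOpen.mem_nhds hj]
      with x hx hi hj
    exact Circle.ext (hx.unique hF (hm₁ i j) (hm₂ i j) (hmreg i j x hi hj) (hreg₀ x)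
      (hreg i x hi.1) (hreg j x hj.1) (hB i j x hi hj))
  let b : Cochain (Additive Circle) W 1 := fun i =>
    ⟨fun x => Additive.ofMul (B (i 0) (i 1) x), continuous_ofMul.comp
      (continuous_iff_continuousAt.2 fun x => (hBcont _ _ x.1 (x.2 0) (x.2 1)).comp
        continuous_subtype_val.continuousAt)⟩
  refine cechClass_eq_zero_of_res_mem hVW ⟨b, ?_⟩
  funext i
  refine ContinuousMap.ext fun x => ?_
  obtain ⟨i, j, k, rfl⟩ : ∃ i' j' k', i = ![i', j', k'] :=
    ⟨i 0, i 1, i 2, by ext k; fin_cases k <;> rfl⟩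
  have hi : x.1 ∈ W.nhd i := x.2 0
  have hj : x.1 ∈ W.nhd j := x.2 1
  have hk : x.1 ∈ W.nhd k := x.2 2
  have h5 : B i j x * B j k x = (g.1 ![i, j, k] ⟨x.1, fun k => hVW _ (x.2 k)⟩).toMul *
      B i k x := by
    -- Each phase uses its own base point `m p q`; all three are pushed down to M before they are
    -- compared.
    let M := min l₀ (min (ℓ i) (min (ℓ j) (ℓ k)))
    have hM : IsRegularAt F x.1 M := (hreg₀ _).min ((hreg _ _ hi.1).min
      ((hreg _ _ hj.1).min (hreg _ _ hk.1)))
    have hM₀ : M ≤ l₀ := min_le_left _ _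
    have hM₁ : M ≤ ℓ i := (min_le_right _ _).trans (min_le_left _ _)
    have hM₂ : M ≤ ℓ j := (min_le_right _ _).trans ((min_le_right _ _).trans (min_le_left _ _))
    have hM₃ : M ≤ ℓ k := (min_le_right _ _).trans ((min_le_right _ _).trans (min_le_right _ _))
    have key : ∀ p q, x.1 ∈ W.nhd p → x.1 ∈ W.nhd q → M ≤ ℓ p → M ≤ ℓ q →
        IsTransition (F x.1).1 M (t p x) (t q x) (s p q x) (B p q x) := fun p q hp hq hMp hMq =>
      (hB p q x hp hq).of_le hF (le_min hM₀ (le_min hMp hMq)) (hm₀ p q) (hm₁ p q) (hm₂ p q) hM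
        (hmreg p q x hp hq) (hreg₀ x) (hreg p x hp.1) (hreg q x hq.1)
    have h8 := IsTransition.mul_eq hF (ht i) (ht j) (ht k) (hs i j)
      (hs j k) hi.2 hj.2 hk.2 ⟨hi.1, hj.1⟩ ⟨hj.1, hk.1⟩
      (hg i j k ⟨x.1, fun k => hVW _ (x.2 k)⟩) hM₀ hM₁ hM₂ hM₃ hM (hreg₀ x) (hreg _ _ hi.1)
      (hreg _ _ hj.1) (hreg _ _ hk.1) (key _ _ hi hj hM₁ hM₂) (key _ _ hj hk hM₂ hM₃)
      (key _ _ hi hk hM₁ hM₃)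
    exact Circle.ext h8
  rw [← Cochain.eval_of_mem _ x.2, eval_cechD_one b hi hj hk,
    Cochain.eval_of_mem b (PointedCover.mem_inter_two hi hj),
    Cochain.eval_of_mem b (PointedCover.mem_inter_two hi hk),
    Cochain.eval_of_mem b (PointedCover.mem_inter_two hj hk), res_apply]
  apply Additive.toMul.injective
  change B j k x / B i k x * B i j x = _
  rw [div_mul_eq_mul_div, mul_comm, h5, mul_div_cancel_right]

end GerbeClass

/-! ### Local lifts through the exponential. -/

section Exponential

theorem expTwoPi_add (s t : ℝ) : expTwoPi (s + t) = expTwoPi s + expTwoPi t := by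
  change Additive.ofMul (Circle.exp (2 * Real.pi * (s + t))) = _
  rw [mul_add, Circle.exp_add]
  rfl

theorem expTwoPi_sub (s t : ℝ) : expTwoPi (s - t) = expTwoPi s - expTwoPi t := by
  rw [eq_sub_iff_add_eq, ← expTwoPi_add, sub_add_cancel]

theorem exists_int_of_expTwoPi_eq_zero {t : ℝ} (h : expTwoPi t = 0) : ∃ n : ℤ, t = n := by
  have h1 : Circle.exp (2 * Real.pi * t) = 1 := h
  obtain ⟨n, hn⟩ := Circle.exp_eq_one.1 h1
  exact ⟨n, mul_left_cancel₀ Real.two_pi_pos.ne' (by linarith)⟩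

/-- After division by its value at x₀, B is near 1, where the principal argument is continuous. -/
theorem exists_local_lift {X : Type*} [TopologicalSpace X] {B : X → Additive Circle} {S : Set X}
    (hS : IsOpen S) (hB : ContinuousOn B S) {x₀ : X} (hx₀ : x₀ ∈ S) :
    ∃ (O : Set X) (β : X → ℝ), IsOpen O ∧ x₀ ∈ O ∧ ContinuousOn β O ∧
      ∀ x ∈ O, expTwoPi (β x) = B x := by
  let q : X → ℂ := fun x => (((B x).toMul / (B x₀).toMul : Circle) : ℂ)
  have hq : ContinuousOn q S :=
    Continuous.comp_continuousOn (by fun_prop : Continuous fun z : Circle => (z : ℂ))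
      ((continuous_toMul.comp_continuousOn hB).div' continuousOn_const)
  have hexp : ∀ z : Circle, expTwoPi (Complex.arg z / (2 * Real.pi)) = Additive.ofMul z := by
    intro z
    change Additive.ofMul (Circle.exp (2 * Real.pi * (Complex.arg z / (2 * Real.pi)))) = _
    rw [mul_div_cancel₀ _ Real.two_pi_pos.ne', Circle.exp_arg]
  refine ⟨S ∩ q ⁻¹' Complex.slitPlane,
    fun x => Complex.arg (B x₀).toMul / (2 * Real.pi) + Complex.arg (q x) / (2 * Real.pi),
    hq.isOpen_inter_preimage hS Complex.isOpen_slitPlane, ⟨hx₀, ?_⟩, ?_, fun x hx => ?_⟩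
  · simp [q]
  · refine continuousOn_const.add (ContinuousOn.div_const (fun x hx => ?_) _)
    exact (Complex.continuousAt_arg hx.2).comp_continuousWithinAt
      ((hq x hx.1).mono inter_subset_left)
  · rw [expTwoPi_add, hexp, hexp, ← ofMul_mul, mul_div_cancel]
    rfl

end Exponential

/-! ### Refinements adapted to local data on double intersections. -/

section Refinement

/-- A cover of a paracompact Hausdorff space has a refinement `N`, with refining map `r`, such that
`N x` is contained in a prescribed neighbourhood of `x` in `W (r x) ∩ W (r y)` whenever `N x` meets
`N y`. -/
theorem exists_refinement {X : Type*} [TopologicalSpace X] [ParacompactSpace X] [T2Space X]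
    (W : PointedCover X) (O : X → X → X → Set X)
    (hO : ∀ i j x, x ∈ W.nhd i → x ∈ W.nhd j → O i j x ∈ 𝓝 x) :
    ∃ (N : PointedCover X) (r : X → X), W ≤ N ∧ (∀ x, N.nhd x ≤ W.nhd (r x)) ∧
      ∀ x y, ((N.nhd x : Set X) ∩ N.nhd y).Nonempty →
        x ∈ W.nhd (r x) ∧ x ∈ W.nhd (r y) ∧ (N.nhd x : Set X) ⊆ O (r x) (r y) x := by
  -- Locally finite u inside W, then v with closures inside u; `r x` names a member of v containing
  -- x.
  obtain ⟨u, huo, hu, huf, huW⟩ := precise_refinement (fun x => (W.nhd x : Set X))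
    (fun x => (W.nhd x).isOpen) (iUnion_eq_univ_iff.2 fun x => ⟨x, W.mem x⟩)
  obtain ⟨v, hv, hvo, hvu⟩ := exists_iUnion_eq_closure_subset huo huf.point_finite hu
  have hvf : LocallyFinite fun i => closure (v i) := huf.subset hvu
  choose r hr using iUnion_eq_univ_iff.1 hv
  have hfin : ∀ x, {i | x ∈ u i}.Finite := huf.point_finite
  have hN : ∀ x, ∃ N : Opens X, x ∈ N ∧ N ≤ W.nhd x ∧ (N : Set X) ⊆ v (r x) ∧
      (∀ i j, x ∈ u i → x ∈ u j → (N : Set X) ⊆ O i j x) ∧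
      ∀ i, x ∉ u i → Disjoint (N : Set X) (v i) := by
    intro x
    -- Only finitely many u i contain x, so finitely many neighbourhoods O i j x are intersected.
    have h1 : ∀ᶠ y in 𝓝 x, ∀ i ∈ {i | x ∈ u i}, ∀ j ∈ {j | x ∈ u j}, y ∈ O i j x :=
      (hfin x).eventually_all.2 fun i hi => (hfin x).eventually_all.2 fun j hj =>
        hO i j x (huW i hi) (huW j hj)
    have h2 : IsClosed (⋃ i : {i // x ∉ u i}, closure (v i)) :=
      (hvf.comp_injective Subtype.val_injective).isClosed_iUnion fun i => isClosed_closure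
    have h3 : ∀ᶠ y in 𝓝 x, y ∉ ⋃ i : {i // x ∉ u i}, closure (v i) := by
      refine h2.isOpen_compl.mem_nhds ?_
      simp only [mem_compl_iff, mem_iUnion, not_exists]
      exact fun i hi => i.2 (hvu i hi)
    have h4 : ∀ᶠ y in 𝓝 x, y ∈ W.nhd x := (W.nhd x).isOpen.mem_nhds (W.mem x)
    have h5 : ∀ᶠ y in 𝓝 x, y ∈ v (r x) := (hvo (r x)).mem_nhds (hr x)
    obtain ⟨N, hN, hNo, hxN⟩ := eventually_nhds_iff.1 (h1.and (h3.and (h4.and h5)))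
    refine ⟨⟨N, hNo⟩, hxN, fun y hy => (hN y hy).2.2.1, fun y hy => (hN y hy).2.2.2,
      fun i j hi hj y hy => (hN y hy).1 i hi j hj, fun i hi => Set.disjoint_left.2 fun y hy hyv => ?_⟩
    exact (hN y hy).2.1 (mem_iUnion.2 ⟨⟨i, hi⟩, subset_closure hyv⟩)
  choose N hxN hNW hNv hNO hNd using hN
  refine ⟨⟨N, hxN⟩, r, hNW, fun x y hy => huW _ (hvu _ (subset_closure (hNv x hy))),
    fun x y ⟨z, hzx, hzy⟩ => ?_⟩
  have hx : x ∈ u (r x) := hvu _ (subset_closure (hr x))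
  -- Otherwise N x would miss v (r y), which contains N y.
  have hxy : x ∈ u (r y) := by
    by_contra h
    exact Set.disjoint_left.1 (hNd x _ h) hzx (hNv y hzy)
  exact ⟨huW _ hx, huW _ hxy, hNO x _ _ hx hxy⟩

end Refinement

/-! ### The connecting homomorphism sends zero only to zero. -/

section Bockstein

variable {X : Type*} [TopologicalSpace X]

theorem continuousOn_eval {A : Type*} [AddCommGroup A] [TopologicalSpace A] {V : PointedCover X}
    {n : ℕ} (c : Cochain A V n) (i : Fin (n + 1) → X) :
    ContinuousOn (Cochain.eval c i) (V.inter i) := by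
  rw [continuousOn_iff_continuous_domRestrict]
  convert (c i).continuous using 1
  ext x
  exact Cochain.eval_of_mem c x.2

/-- The cochain given by functions on `X` that are continuous on the intersections. -/
noncomputable def Cochain.ofEval {A : Type*} [TopologicalSpace A] (V : PointedCover X) {n : ℕ}
    (c : (Fin (n + 1) → X) → X → A) (hc : ∀ i, ContinuousOn (c i) (V.inter i)) :
    Cochain A V n :=
  fun i => ⟨(V.inter i).domRestrict (c i), continuousOn_iff_continuous_domRestrict.1 (hc i)⟩

theorem isOpen_inter (V : PointedCover X) {n : ℕ} (i : Fin (n + 1) → X) : IsOpen (V.inter i) := by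
  have : V.inter i = ⋂ k, (V.nhd (i k) : Set X) := by
    ext x
    simp [PointedCover.inter]
  rw [this]
  exact isOpen_iInter_of_finite fun k => (V.nhd (i k)).isOpen

theorem exists_intCochain {N : PointedCover X} {n : ℕ} (c : Cochain ℝ N n)
    (hc : ∀ i x, expTwoPi (c i x) = 0) : ∃ k : Cochain ℤ N n, ∀ i x, (k i x : ℝ) = c i x := by
  choose k hk using fun i x => exists_int_of_expTwoPi_eq_zero (hc i x)
  refine ⟨fun i => ⟨k i, ?_⟩, fun i x => (hk i x).symm⟩
  rw [Int.isClosedEmbedding_coe_real.isInducing.continuous_iff]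
  convert (c i).continuous using 1
  ext x
  exact (hk i x).symm

theorem intCast_cechD {V : PointedCover X} {n : ℕ} {k : Cochain ℤ V n} {c : Cochain ℝ V n}
    (h : ∀ i x, (k i x : ℝ) = c i x) (i : Fin (n + 2) → X) (x : V.inter i) :
    ((cechD ℤ V n k i x : ℤ) : ℝ) = cechD ℝ V n c i x := by
  rw [cechD_apply, cechD_apply, Int.cast_sum]
  refine Finset.sum_congr rfl fun j _ => ?_
  rw [smul_eq_mul, Int.cast_mul, h, zsmul_eq_mul]

/-- Once a real cochain γ satisfies exp(2πi δγ) = g on a finer cover, f - δγ is an integral cochain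
with coboundary n. -/
theorem eq_zero_of_isBockstein_zero [ParacompactSpace X] [T2Space X] {c : CechCohomology X ℤ 3}
    (h : IsBockstein (0 : CechCohomology X (Additive Circle) 2) c) : c = 0 := by
  obtain ⟨V, f, g, n, hfg, hfn, hg, rfl⟩ := h
  obtain ⟨W, hVW, b, hb⟩ := exists_res_mem_of_cechClass_eq_zero hg
  have hlift : ∀ i j x, ∃ (O : Set X) (β : X → ℝ), x ∈ W.nhd i → x ∈ W.nhd j →
      IsOpen O ∧ x ∈ O ∧ ContinuousOn β O ∧
        ∀ y ∈ O, expTwoPi (β y) = Cochain.eval b ![i, j] y := by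
    intro i j x
    by_cases hx : x ∈ W.nhd i ∧ x ∈ W.nhd j
    · obtain ⟨O, β, h⟩ := exists_local_lift (isOpen_inter W ![i, j]) (continuousOn_eval b ![i, j])
        (PointedCover.mem_inter_two hx.1 hx.2)
      exact ⟨O, β, fun _ _ => h⟩
    · exact ⟨∅, 0, fun hi hj => (hx ⟨hi, hj⟩).elim⟩
  choose O β hO using hlift
  obtain ⟨N, r, hWN, hNr, hNO⟩ := exists_refinement W O fun i j x hi hj =>
    (hO i j x hi hj).1.mem_nhds (hO i j x hi hj).2.1
  have hVr : ∀ {x p}, p ∈ N.nhd x → p ∈ V.nhd (r x) := fun hp => hVW _ (hNr _ hp)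
  have hVN : ∀ {x p}, p ∈ N.nhd x → p ∈ V.nhd x := fun hp => hVW _ (hWN _ hp)
  -- The lift β of b lives along the refining map r, while restriction to N uses the identity on
  -- indices. The two f-terms are the chain homotopy between these refining maps. On N (i 0) ∩ N (i
  -- 1) the lift based at i 0 is used, as N (i 0) lies in its domain.
  let γ : Cochain ℝ N 1 := Cochain.ofEval N
    (fun i p => Cochain.eval f ![i 0, i 1, r (i 1)] p - Cochain.eval f ![i 0, r (i 0), r (i 1)] p +
      β (r (i 0)) (r (i 1)) (i 0) p) (by
    intro i
    refine ((ContinuousOn.mono (continuousOn_eval f _) fun p hp => ?_).sub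
      (ContinuousOn.mono (continuousOn_eval f _) fun p hp => ?_)).add fun p hp => ?_
    · exact PointedCover.mem_inter_three (hVN (hp 0)) (hVN (hp 1)) (hVr (hp 1))
    · exact PointedCover.mem_inter_three (hVN (hp 0)) (hVr (hp 0)) (hVr (hp 1))
    · obtain ⟨h1, h2, h3⟩ := hNO (i 0) (i 1) ⟨p, hp 0, hp 1⟩
      obtain ⟨h4, -, h5, -⟩ := hO _ _ _ h1 h2
      exact (h5.continuousAt (h4.mem_nhds (h3 (hp 0)))).continuousWithinAt)
  have hfg' : ∀ {i j k p}, p ∈ V.nhd i → p ∈ V.nhd j → p ∈ V.nhd k →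
      expTwoPi (Cochain.eval f ![i, j, k] p) = Cochain.eval g.1 ![i, j, k] p := by
    intro i j k p hi hj hk
    have hp := PointedCover.mem_inter_three hi hj hk
    rw [Cochain.eval_of_mem _ hp, Cochain.eval_of_mem _ hp, hfg]
    rfl
  have hγ : ∀ {i j p}, p ∈ N.nhd i → p ∈ N.nhd j → expTwoPi (Cochain.eval γ ![i, j] p) =
      Cochain.eval g.1 ![i, j, r j] p - Cochain.eval g.1 ![i, r i, r j] p +
        Cochain.eval b ![r i, r j] p := by
    intro i j p hi hj
    rw [Cochain.eval_of_mem _ (PointedCover.mem_inter_two hi hj)]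
    change expTwoPi (Cochain.eval f ![i, j, r j] p - Cochain.eval f ![i, r i, r j] p +
      β (r i) (r j) i p) = _
    obtain ⟨h1, h2, h3⟩ := hNO i j ⟨p, hi, hj⟩
    rw [expTwoPi_add, expTwoPi_sub, hfg' (hVN hi) (hVN hj) (hVr hj),
      hfg' (hVN hi) (hVr hi) (hVr hj), (hO _ _ _ h1 h2).2.2.2 p (h3 hi)]
  have hgcoc : ∀ {i j k l p}, p ∈ V.nhd i → p ∈ V.nhd j → p ∈ V.nhd k → p ∈ V.nhd l →
      Cochain.eval g.1 ![j, k, l] p - Cochain.eval g.1 ![i, k, l] p +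
        Cochain.eval g.1 ![i, j, l] p - Cochain.eval g.1 ![i, j, k] p = 0 := by
    intro i j k l p hi hj hk hl
    rw [← eval_cechD_two g.1 hi hj hk hl, AddMonoidHom.mem_ker.1 g.2,
      Cochain.eval_of_mem _ (PointedCover.mem_inter_four hi hj hk hl)]
    rfl
  have hgb : ∀ {i j k p}, p ∈ W.nhd i → p ∈ W.nhd j → p ∈ W.nhd k →
      Cochain.eval g.1 ![i, j, k] p = Cochain.eval b ![j, k] p - Cochain.eval b ![i, k] p +
        Cochain.eval b ![i, j] p := by
    intro i j k p hi hj hk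
    rw [← eval_cechD_one b hi hj hk, hb,
      Cochain.eval_of_mem _ (PointedCover.mem_inter_three hi hj hk),
      Cochain.eval_of_mem _ (PointedCover.mem_inter_three (hVW _ hi) (hVW _ hj) (hVW _ hk)),
      res_apply]
  have hVN' : V ≤ N := hVW.trans hWN
  obtain ⟨k, hk⟩ := exists_intCochain (res hVN' 2 f - cechD ℝ N 1 γ) (by
    intro i x
    obtain ⟨i, j, k, rfl⟩ : ∃ a b c, i = ![a, b, c] :=
      ⟨i 0, i 1, i 2, by ext k; fin_cases k <;> rfl⟩
    have hi : x.1 ∈ N.nhd i := x.2 0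
    have hj : x.1 ∈ N.nhd j := x.2 1
    have hk : x.1 ∈ N.nhd k := x.2 2
    have h1 : (res hVN' 2 f - cechD ℝ N 1 γ) ![i, j, k] x = Cochain.eval f ![i, j, k] x.1 -
        (Cochain.eval γ ![j, k] x.1 - Cochain.eval γ ![i, k] x.1 + Cochain.eval γ ![i, j] x.1) := by
      rw [← eval_cechD_one γ hi hj hk, Cochain.eval_of_mem _ x.2,
        Cochain.eval_of_mem _ (PointedCover.mem_inter_three (hVN hi) (hVN hj) (hVN hk))]
      rfl
    rw [h1, expTwoPi_sub, expTwoPi_add, expTwoPi_sub, hγ hj hk, hγ hi hk, hγ hi hj,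
      hfg' (hVN hi) (hVN hj) (hVN hk)]
    -- The cocycle identity on the three simplices of the prism from (i, j, k) to (r i, r j, r k);
    -- together with g = δb on the end face they give exp(f - δγ) = 1.
    have e1 := hgcoc (hVN hi) (hVr hi) (hVr hj) (hVr hk)
    have e2 := hgcoc (hVN hi) (hVN hj) (hVr hj) (hVr hk)
    have e3 := hgcoc (hVN hi) (hVN hj) (hVN hk) (hVr hk)
    have e4 := hgb (hNr _ hi) (hNr _ hj) (hNr _ hk)
    have e : ∀ a b c : Additive Circle, a = 0 → b = 0 → c = 0 → b - a - c = 0 := by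
      rintro _ _ _ rfl rfl rfl
      simp
    rw [← e _ _ _ e1 e2 e3, e4]
    abel)
  refine cechClass_eq_zero_of_res_mem hVN' ⟨k, ?_⟩
  funext i
  refine ContinuousMap.ext fun x => Int.cast_injective (α := ℝ) ?_
  rw [intCast_cechD hk, map_sub, cechD_cechD_one, sub_zero, cechD_res, res_apply, res_apply, hfn]
  rfl

theorem isBockstein_zero : IsBockstein (0 : CechCohomology X (Additive Circle) 2) 0 := by
  refine ⟨⟨fun _ => ⊤, fun _ => trivial⟩, 0, 0, 0, fun i => ?_, fun i => ?_,
    cechClass_zero _ _, cechClass_zero _ _⟩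
  · refine ContinuousMap.ext fun x => ?_
    have h : expTwoPi 0 = 0 := by simpa using expTwoPi_sub 0 0
    exact h.symm
  · rw [map_zero]
    refine ContinuousMap.ext fun x => ?_
    exact Int.cast_zero.symm

end Bockstein

end FermiGerbe

theorem mainTheorem5 {X : Type*} [TopologicalSpace X] [ParacompactSpace X]
    {H : Type*} [NormedAddCommGroup H] [InnerProductSpace ℂ H] [CompleteSpace H]
    (F : X → FermiGerbe.CFsa H) (hF : Continuous F)
    (hgap : ∀ x, Disjoint (Set.Ioo (-1 : ℝ) 1) (FermiGerbe.essentialSpectrum (F x).1))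
    (l₀ : ℝ) (hl₀ : l₀ ∈ Set.Ioo (-1 : ℝ) 1)
    (hspec : ∀ x, l₀ ∉ FermiGerbe.spectrum (F x).1) :
    (∀ u : FermiGerbe.CechCohomology X (Additive Circle) 2,
      FermiGerbe.IsGerbeClass F u ↔ u = 0) ∧
    (T2Space X → ∀ c : FermiGerbe.CechCohomology X ℤ 3,
      FermiGerbe.IsDixmierDouadyInvariant F c ↔ c = 0) := by
  have h : ∀ u : FermiGerbe.CechCohomology X (Additive Circle) 2,
      FermiGerbe.IsGerbeClass F u ↔ u = 0 := fun u =>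
    ⟨FermiGerbe.eq_zero_of_isGerbeClass ⟨hF, hgap, hspec⟩ hl₀, by
      rintro rfl
      exact FermiGerbe.isGerbeClass_zero hl₀ hspec⟩
  refine ⟨h, fun _ c => ⟨?_, ?_⟩⟩
  · rintro ⟨u, hu, hc⟩
    rw [(h u).1 hu] at hc
    exact FermiGerbe.eq_zero_of_isBockstein_zero hc
  · rintro rfl
    exact ⟨0, (h 0).2 rfl, FermiGerbe.isBockstein_zero⟩
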